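/- Let $d\ge 2$ and let $G$ be the semigroup of $d\times d$ real matrices with nonnegative entries having a positive entry in every row and in every column; let $G^+\subset G$ be the set of matrices all of whose entries are positive. Let $\|\cdot\|$ be the $\ell^1$ norm on $\mathbb R^d$ and also the associated operator norm, $S^+=\{x\in\mathbb R^d:\|x\|=1,\ x_i\ge 0\ \forall i\}$, $v(g)=\inf_{x\in S^+}\|gx\|$, $N(g)=\max(\|g\|,1/v(g))$ and $\sigma(g,x)=\log\|gx\|$ for $g\in G$, $x\in S^+$. A Borel probability measure $\mu$ on $G$ admits a moment of order $p$ if $\int_G(\log N(g))^p\,d\mu(g)<\infty$, and it is strictly contracting if $\mu^{*r}(G^+)>0$ for some integer $r\ge 1$. Let $\tilde\mu$ be the image of $\mu$ under $g\mapsto g^t$. Let $\mu$ be strictly contracting with a moment of order $p\ge 1$, let $(Y_n)_{n\ge1}$ be iid random variables with law $\mu$, and put $A_n=Y_n\cdots Y_1$. Let $\lambda_\mu=\lim_n\frac1n\int_G\log\|g\|\,d\mu^{*n}(g)$; this is also the almost sure and $L^1$ limit of $\frac1n\log\|A_n\|$. Let $\alpha\in(1/2,1]$ with $\alpha\ge 1/p$.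 Then for every $\varepsilon>0$, $$\sum_{n\ge1}n^{\alpha p-2}\sup_{x\in S^+}\mathbb P\Big(\max_{1\le k\le n}|\sigma(A_k,x)-k\lambda_\mu|\ge n^\alpha\varepsilon\Big)<\infty .$$ If moreover $\tilde\mu$ admits a moment of order $p$, then for every $\varepsilon>0$, $$\sum_{n\ge1}n^{\alpha p-2}\,\mathbb P\Big(\sup_{x,y\in S^+}|\log\langle y,A_nx\rangle-n\lambda_\mu|\ge n^\alpha\varepsilon\Big)<\infty ,$$ where $\log 0=-\infty$ and $|-\infty|=+\infty$. -/

import Mathlib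

open MeasureTheory ProbabilityTheory Filter Topology
open scoped ENNReal NNReal

noncomputable section

namespace PosMat

/-- The semigroup `G` of `d × d` real matrices with nonnegative entries such that every row and
every column has a (strictly) positive entry. -/
def allowable (d : ℕ) : Submonoid (Matrix (Fin d) (Fin d) ℝ) where
  carrier := {g | (∀ i j, 0 ≤ g i j) ∧ (∀ i, ∃ j, 0 < g i j) ∧ (∀ j, ∃ i, 0 < g i j)}
  mul_mem' := by
    rintro a b ⟨ha, har, hac⟩ ⟨hb, hbr, hbc⟩
    refine ⟨fun i j => ?_, fun i => ?_, fun j => ?_⟩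
    · rw [Matrix.mul_apply]
      exact Finset.sum_nonneg fun k _ => mul_nonneg (ha i k) (hb k j)
    · obtain ⟨k, hk⟩ := har i
      obtain ⟨j, hj⟩ := hbr k
      refine ⟨j, ?_⟩
      rw [Matrix.mul_apply]
      exact Finset.sum_pos' (fun k _ => mul_nonneg (ha i k) (hb k j))
        ⟨k, Finset.mem_univ k, mul_pos hk hj⟩
    · obtain ⟨k, hk⟩ := hbc j
      obtain ⟨i, hi⟩ := hac k
      refine ⟨i, ?_⟩
      rw [Matrix.mul_apply]
      exact Finset.sum_pos' (fun k _ => mul_nonneg (ha i k) (hb k j))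
        ⟨k, Finset.mem_univ k, mul_pos hi hk⟩
  one_mem' := by
    refine ⟨fun i j => ?_, fun i => ⟨i, by simp⟩, fun j => ⟨j, by simp⟩⟩
    rw [Matrix.one_apply]
    split_ifs <;> norm_num

/-- `G`, with the topology inherited from the space of matrices. -/
abbrev G (d : ℕ) : Type := allowable d

/-- `G` carries its Borel σ-algebra. -/
instance instMeasurableSpaceG (d : ℕ) : MeasurableSpace (G d) := borel (G d)

instance instBorelSpaceG (d : ℕ) : BorelSpace (G d) := ⟨rfl⟩

/-- `G⁺`: the matrices all of whose entries are positive. -/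
def strictlyPositive (d : ℕ) : Set (G d) := {g | ∀ i j, 0 < g.1 i j}

/-- The map `g ↦ gᵗ` on `G`. -/
def transpose {d : ℕ} (g : G d) : G d :=
  ⟨g.1.transpose, fun i j => g.2.1 j i, fun i => g.2.2.2 i, fun j => g.2.2.1 j⟩

/-- The `ℓ¹` norm on `ℝᵈ`. -/
def l1Norm {d : ℕ} (x : Fin d → ℝ) : ℝ := ∑ i, |x i|

/-- `S⁺`: the vectors of `ℓ¹` norm one with nonnegative coordinates. -/
def simplex (d : ℕ) : Set (Fin d → ℝ) := {x | l1Norm x = 1 ∧ ∀ i, 0 ≤ x i}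

/-- The operator norm `‖g‖ = sup_{‖x‖ = 1} ‖g x‖` for the `ℓ¹` norm. -/
def opNorm {d : ℕ} (g : G d) : ℝ := ⨆ x : {x : Fin d → ℝ // l1Norm x = 1}, l1Norm (g.1.mulVec x)

/-- `v(g) = inf_{x ∈ S⁺} ‖g x‖`. -/
def lowNorm {d : ℕ} (g : G d) : ℝ := ⨅ x : simplex d, l1Norm (g.1.mulVec x)

/-- `N(g) = max (‖g‖, 1 / v(g))`. -/
def sizeN {d : ℕ} (g : G d) : ℝ := max (opNorm g) (1 / lowNorm g)

/-- The norm cocycle `σ(g, x) = log ‖g x‖`. -/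
def cocycle {d : ℕ} (g : G d) (x : simplex d) : ℝ := Real.log (l1Norm (g.1.mulVec x))

/-- `μ` admits a moment of order `p`: `∫ (log N(g))^p dμ(g) < ∞`. -/
def HasMoment {d : ℕ} (μ : Measure (G d)) (p : ℝ) : Prop :=
  ∫⁻ g, ENNReal.ofReal (Real.log (sizeN g) ^ p) ∂μ < ∞

/-- The convolution power `μ^{*n}`, the law of a product of `n` independent elements of law `μ`. -/
def convPow {d : ℕ} (μ : Measure (G d)) : ℕ → Measure (G d)
  | 0 => Measure.dirac 1
  | n + 1 => Measure.mconv μ (convPow μ n)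

/-- `μ` is strictly contracting: `μ^{*r}(G⁺) > 0` for some `r ≥ 1`. -/
def StrictlyContracting {d : ℕ} (μ : Measure (G d)) : Prop :=
  ∃ r : ℕ, 1 ≤ r ∧ 0 < convPow μ r (strictlyPositive d)

/-- The Lyapunov exponent `λ_μ = lim (1/n) ∫ log ‖g‖ dμ^{*n}(g)`. -/
def lyapunov {d : ℕ} (μ : Measure (G d)) : ℝ :=
  limUnder atTop fun n : ℕ => (∫ g, Real.log (opNorm g) ∂(convPow μ n)) / (n : ℝ)

/-- The left products. The sequence is indexed from `0`, so that `Y 0` is the first factor and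
`leftProd Y n = Y (n - 1) * ⋯ * Y 0` is the product of the first `n` factors. -/
def leftProd {d : ℕ} {Ω : Type*} (Y : ℕ → Ω → G d) : ℕ → Ω → G d
  | 0 => fun _ => 1
  | n + 1 => fun ω => Y n ω * leftProd Y n ω

/-- `log ⟨y, g x⟩` as an extended real number, equal to `-∞` when `⟨y, g x⟩ = 0`. -/
def logCoeff {d : ℕ} (g : G d) (x y : simplex d) : EReal :=
  ENNReal.log (ENNReal.ofReal (dotProduct y.1 (g.1.mulVec x)))

end PosMat

end

/-! On the nonnegative cone `‖g x‖` is linear in `x`, so `‖g‖` and `v(g)` are the largest and the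
smallest column sums, both attained at vertices of the simplex. The distance between `σ(g, x)` and
`log ‖g‖` is at most the oscillation `osc g = log ‖g‖ - log v(g)`.

Strict contraction makes this oscillation bounded in mean (`exists_integral_osc_le`). With positive
probability a block of `r` factors has all its entries in `[1/M, M]`. Such a block at the right end
of a product bounds the oscillation whatever the other factors are; any other block adds at most its
own oscillation. Hence the mean of `log ‖A_n‖` is both subadditive and superadditive up to a
constant. Fekete's lemma, used from both sides, keeps it within a constant of `n λ_μ`, and so is the
mean of `σ(A_n, x)`, uniformly in `x`.

For a fixed horizon `n`, the Doob martingale obtained by conditioning `σ(A_n, x)` on the first `k`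
factors therefore differs from `σ(A_k, x) - k λ_μ` by a bounded amount for all `k ≤ n` at once, and
its increments are dominated by `log N` of the current factor plus a constant. This reduces the
first series to a Baum-Katz theorem for martingales whose increments have a common dominating
function with a moment of order `p` (`exists_maximal_bound`). The increments are truncated at a
multiple of `n^α`. The truncated sums are controlled by Kolmogorov's inequality if `p < 2` and by an
exponential inequality if `p ≥ 2`, and the resulting series are summed by Tonelli. The case `p = α =
1`, applied at the vertices, gives the strong law for `log ‖A_n‖`; domination by the averages of
`log N(Y_i)` then gives the `L¹` limit.

If every entry of `A_n` is at least `exp (-z)` times its column sum, then every `⟨y, A_n x⟩` lies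
between `exp (-z) v(A_n)` and `‖A_n‖`, two quantities read off from the cocycle at the `d` vertices.
It remains to sum the probabilities that this balance fails with `z` of order `n^α`
(`tsum_measure_not_colBalanced_lt_top`). Peeling off blocks of `r` factors from the left, the
balance is restored by the first block with entries in `[1/M, M]`. The number of blocks before it
has geometric tails, and each of them costs at most `log N(Z) + log N(Zᵗ)`; this is where the moment
of the transposed law enters. -/

noncomputable section

/-! ### Column sums, norms and the cocycle -/

namespace PosMat

variable {d : ℕ}

/-- The sum of the entries of the `j`-th column. -/
def colSum (g : G d) (j : Fin d) : ℝ := ∑ i, g.1 i j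

lemma colSum_pos (g : G d) (j : Fin d) : 0 < colSum g j := by
  obtain ⟨i, hi⟩ := g.2.2.2 j
  exact Finset.sum_pos' (fun k _ => g.2.1 k j) ⟨i, Finset.mem_univ i, hi⟩

lemma l1Norm_of_nonneg {x : Fin d → ℝ} (hx : ∀ i, 0 ≤ x i) : l1Norm x = ∑ i, x i :=
  Finset.sum_congr rfl fun i _ => abs_of_nonneg (hx i)

lemma mulVec_nonneg (g : G d) {x : Fin d → ℝ} (hx : ∀ i, 0 ≤ x i) (i : Fin d) :
    0 ≤ g.1.mulVec x i := by
  rw [Matrix.mulVec, dotProduct]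
  exact Finset.sum_nonneg fun j _ => mul_nonneg (g.2.1 i j) (hx j)

/-- Without cancellation the `ℓ¹` norm is additive. This linearity in `x` is what reduces `opNorm`
and `lowNorm` to extremal column sums. -/
lemma l1Norm_mulVec (g : G d) {x : Fin d → ℝ} (hx : ∀ i, 0 ≤ x i) :
    l1Norm (g.1.mulVec x) = ∑ j, colSum g j * x j := by
  rw [l1Norm_of_nonneg (mulVec_nonneg g hx)]
  simp only [Matrix.mulVec, dotProduct, colSum, Finset.sum_mul]
  exact Finset.sum_comm

lemma sum_simplex (x : simplex d) : ∑ i, x.1 i = 1 := by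
  rw [← l1Norm_of_nonneg x.2.2]; exact x.2.1

/-- The vertices of the simplex. -/
def vertex (j : Fin d) : simplex d :=
  ⟨Pi.single j 1, by
    have h : ∀ i, 0 ≤ (Pi.single j (1 : ℝ) : Fin d → ℝ) i := fun i => by
      by_cases hij : i = j
      · subst hij; simp
      · simp [Pi.single_eq_of_ne hij]
    exact ⟨by rw [l1Norm_of_nonneg h]; simp, h⟩⟩

lemma l1Norm_mulVec_vertex (g : G d) (j : Fin d) :
    l1Norm (g.1.mulVec (vertex j).1) = colSum g j := by
  rw [l1Norm_mulVec g (vertex j).2.2]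
  simp [vertex, Pi.single_apply]

lemma exists_max_colSum [NeZero d] (g : G d) : ∃ j, ∀ k, colSum g k ≤ colSum g j := by
  obtain ⟨j, -, hj⟩ := Finset.exists_max_image Finset.univ (colSum g) ⟨0, Finset.mem_univ _⟩
  exact ⟨j, fun k => hj k (Finset.mem_univ k)⟩

lemma exists_min_colSum [NeZero d] (g : G d) : ∃ j, ∀ k, colSum g j ≤ colSum g k := by
  obtain ⟨j, -, hj⟩ := Finset.exists_min_image Finset.univ (colSum g) ⟨0, Finset.mem_univ _⟩
  exact ⟨j, fun k => hj k (Finset.mem_univ k)⟩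

lemma l1Norm_mulVec_le (g : G d) {j : Fin d} (hj : ∀ k, colSum g k ≤ colSum g j)
    {x : Fin d → ℝ} (hx : l1Norm x = 1) : l1Norm (g.1.mulVec x) ≤ colSum g j := by
  have h0 : ∀ i, 0 ≤ |x i| := fun i => abs_nonneg _
  have h1 : l1Norm (g.1.mulVec x) ≤ l1Norm (g.1.mulVec fun i => |x i|) := by
    refine Finset.sum_le_sum fun i _ => ?_
    rw [abs_of_nonneg (mulVec_nonneg g h0 i)]
    simp only [Matrix.mulVec, dotProduct]
    refine (Finset.abs_sum_le_sum_abs _ _).trans (Finset.sum_le_sum fun k _ => ?_)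
    rw [abs_mul, abs_of_nonneg (g.2.1 i k)]
  refine h1.trans ?_
  rw [l1Norm_mulVec g h0]
  calc ∑ k, colSum g k * |x k| ≤ ∑ k, colSum g j * |x k| :=
        Finset.sum_le_sum fun k _ => mul_le_mul_of_nonneg_right (hj k) (h0 k)
    _ = colSum g j := by rw [← Finset.mul_sum]; simp only [l1Norm] at hx; rw [hx, mul_one]

lemma opNorm_eq {g : G d} {j : Fin d} (hj : ∀ k, colSum g k ≤ colSum g j) :
    opNorm g = colSum g j := by
  have : Nonempty {x : Fin d → ℝ // l1Norm x = 1} := ⟨⟨_, (vertex j).2.1⟩⟩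
  refine le_antisymm (ciSup_le fun x => l1Norm_mulVec_le g hj x.2) ?_
  rw [← l1Norm_mulVec_vertex]
  exact le_ciSup (f := fun x : {x : Fin d → ℝ // l1Norm x = 1} => l1Norm (g.1.mulVec x))
    ⟨colSum g j, by rintro _ ⟨x, rfl⟩; exact l1Norm_mulVec_le g hj x.2⟩ ⟨_, (vertex j).2.1⟩

lemma le_l1Norm_mulVec (g : G d) {j : Fin d} (hj : ∀ k, colSum g j ≤ colSum g k)
    (x : simplex d) : colSum g j ≤ l1Norm (g.1.mulVec x.1) := by
  rw [l1Norm_mulVec g x.2.2]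
  calc colSum g j = ∑ k, colSum g j * x.1 k := by rw [← Finset.mul_sum, sum_simplex, mul_one]
    _ ≤ _ := Finset.sum_le_sum fun k _ => mul_le_mul_of_nonneg_right (hj k) (x.2.2 k)

lemma lowNorm_eq {g : G d} {j : Fin d} (hj : ∀ k, colSum g j ≤ colSum g k) :
    lowNorm g = colSum g j := by
  have : Nonempty (simplex d) := ⟨vertex j⟩
  refine le_antisymm ?_ (le_ciInf fun x => le_l1Norm_mulVec g hj x)
  rw [← l1Norm_mulVec_vertex]
  exact ciInf_le (f := fun x : simplex d => l1Norm (g.1.mulVec x))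
    ⟨colSum g j, by rintro _ ⟨x, rfl⟩; exact le_l1Norm_mulVec g hj x⟩ (vertex j)

variable [NeZero d]

lemma opNorm_eq_iSup (g : G d) : opNorm g = ⨆ j, colSum g j := by
  obtain ⟨j, hj⟩ := exists_max_colSum g
  rw [opNorm_eq hj]
  exact le_antisymm (le_ciSup (Set.finite_range _).bddAbove j) (ciSup_le hj)

lemma lowNorm_eq_iInf (g : G d) : lowNorm g = ⨅ j, colSum g j := by
  obtain ⟨j, hj⟩ := exists_min_colSum g
  rw [lowNorm_eq hj]
  exact le_antisymm (le_ciInf hj) (ciInf_le (Set.finite_range _).bddBelow j)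

lemma colSum_le_opNorm (g : G d) (j : Fin d) : colSum g j ≤ opNorm g := by
  obtain ⟨k, hk⟩ := exists_max_colSum g
  rw [opNorm_eq hk]; exact hk j

lemma lowNorm_le_colSum (g : G d) (j : Fin d) : lowNorm g ≤ colSum g j := by
  obtain ⟨k, hk⟩ := exists_min_colSum g
  rw [lowNorm_eq hk]; exact hk j

lemma exists_opNorm_eq (g : G d) : ∃ j, opNorm g = colSum g j :=
  (exists_max_colSum g).imp fun _ h => opNorm_eq h

lemma exists_lowNorm_eq (g : G d) : ∃ j, lowNorm g = colSum g j :=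
  (exists_min_colSum g).imp fun _ h => lowNorm_eq h

lemma lowNorm_pos (g : G d) : 0 < lowNorm g := by
  obtain ⟨j, hj⟩ := exists_lowNorm_eq g
  rw [hj]; exact colSum_pos g j

lemma lowNorm_le_opNorm (g : G d) : lowNorm g ≤ opNorm g :=
  (lowNorm_le_colSum g 0).trans (colSum_le_opNorm g 0)

lemma opNorm_pos (g : G d) : 0 < opNorm g := (lowNorm_pos g).trans_le (lowNorm_le_opNorm g)

lemma mulVec_le_opNorm (g : G d) {x : Fin d → ℝ} (hx : ∀ i, 0 ≤ x i) :
    l1Norm (g.1.mulVec x) ≤ opNorm g * ∑ i, x i := by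
  rw [l1Norm_mulVec g hx, Finset.mul_sum]
  exact Finset.sum_le_sum fun j _ => mul_le_mul_of_nonneg_right (colSum_le_opNorm g j) (hx j)

lemma lowNorm_le_mulVec (g : G d) {x : Fin d → ℝ} (hx : ∀ i, 0 ≤ x i) :
    lowNorm g * ∑ i, x i ≤ l1Norm (g.1.mulVec x) := by
  rw [l1Norm_mulVec g hx, Finset.mul_sum]
  exact Finset.sum_le_sum fun j _ => mul_le_mul_of_nonneg_right (lowNorm_le_colSum g j) (hx j)

omit [NeZero d] in
lemma colSum_mul (g h : G d) (j : Fin d) : colSum (g * h) j = ∑ k, colSum g k * h.1 k j := by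
  simp only [colSum, Submonoid.coe_mul, Matrix.mul_apply, Finset.sum_mul]
  exact Finset.sum_comm

lemma colSum_mul_le (g h : G d) (j : Fin d) : colSum (g * h) j ≤ opNorm g * colSum h j := by
  rw [colSum_mul]
  simp only [colSum, Finset.mul_sum]
  exact Finset.sum_le_sum fun k _ => mul_le_mul_of_nonneg_right (colSum_le_opNorm g k) (h.2.1 k j)

lemma le_colSum_mul (g h : G d) (j : Fin d) : lowNorm g * colSum h j ≤ colSum (g * h) j := by
  rw [colSum_mul]
  simp only [colSum, Finset.mul_sum]
  exact Finset.sum_le_sum fun k _ => mul_le_mul_of_nonneg_right (lowNorm_le_colSum g k) (h.2.1 k j)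

lemma opNorm_mul_le (g h : G d) : opNorm (g * h) ≤ opNorm g * opNorm h := by
  obtain ⟨j, hj⟩ := exists_opNorm_eq (g * h)
  rw [hj]
  exact (colSum_mul_le g h j).trans
    (mul_le_mul_of_nonneg_left (colSum_le_opNorm h j) (opNorm_pos g).le)

lemma le_lowNorm_mul (g h : G d) : lowNorm g * lowNorm h ≤ lowNorm (g * h) := by
  obtain ⟨j, hj⟩ := exists_lowNorm_eq (g * h)
  rw [hj]
  exact (mul_le_mul_of_nonneg_left (lowNorm_le_colSum h j) (lowNorm_pos g).le).trans
    (le_colSum_mul g h j)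

lemma le_opNorm_mul (g h : G d) : lowNorm g * opNorm h ≤ opNorm (g * h) := by
  obtain ⟨j, hj⟩ := exists_opNorm_eq h
  rw [hj]
  exact (le_colSum_mul g h j).trans (colSum_le_opNorm _ j)

/-- `log N(g)`. -/
def logN (g : G d) : ℝ := Real.log (sizeN g)

/-- The oscillation `log ‖g‖ - log v(g)` of the cocycle `σ(g, ·)`. -/
def osc (g : G d) : ℝ := Real.log (opNorm g) - Real.log (lowNorm g)

lemma logN_eq (g : G d) : logN g = max (Real.log (opNorm g)) (-Real.log (lowNorm g)) := by
  rw [logN, sizeN, one_div, ← Real.log_inv]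
  rcases le_total (opNorm g) (lowNorm g)⁻¹ with h | h
  · rw [max_eq_right h, max_eq_right (Real.log_le_log (opNorm_pos g) h)]
  · rw [max_eq_left h, max_eq_left (Real.log_le_log (inv_pos.2 (lowNorm_pos g)) h)]

lemma log_opNorm_le_logN (g : G d) : Real.log (opNorm g) ≤ logN g :=
  (le_max_left _ _).trans (logN_eq g).ge

lemma neg_logN_le (g : G d) : -logN g ≤ Real.log (lowNorm g) :=
  neg_le.1 ((le_max_right _ _).trans (logN_eq g).ge)

lemma log_lowNorm_le (g : G d) : Real.log (lowNorm g) ≤ Real.log (opNorm g) :=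
  Real.log_le_log (lowNorm_pos g) (lowNorm_le_opNorm g)

lemma abs_log_opNorm_le (g : G d) : |Real.log (opNorm g)| ≤ logN g :=
  abs_le.2 ⟨(neg_logN_le g).trans (log_lowNorm_le g), log_opNorm_le_logN g⟩

lemma logN_nonneg (g : G d) : 0 ≤ logN g := (abs_nonneg _).trans (abs_log_opNorm_le g)

lemma osc_nonneg (g : G d) : 0 ≤ osc g := sub_nonneg.2 (log_lowNorm_le g)

lemma osc_le (g : G d) : osc g ≤ 2 * logN g := by
  have := log_opNorm_le_logN g
  have := neg_logN_le g
  unfold osc; linarith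

lemma log_opNorm_mul_le (g h : G d) :
    Real.log (opNorm (g * h)) ≤ Real.log (opNorm g) + Real.log (opNorm h) := by
  rw [← Real.log_mul (opNorm_pos g).ne' (opNorm_pos h).ne']
  exact Real.log_le_log (opNorm_pos _) (opNorm_mul_le g h)

lemma le_log_lowNorm_mul (g h : G d) :
    Real.log (lowNorm g) + Real.log (lowNorm h) ≤ Real.log (lowNorm (g * h)) := by
  rw [← Real.log_mul (lowNorm_pos g).ne' (lowNorm_pos h).ne']
  exact Real.log_le_log (mul_pos (lowNorm_pos g) (lowNorm_pos h)) (le_lowNorm_mul g h)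

lemma le_log_opNorm_mul (g h : G d) :
    Real.log (lowNorm g) + Real.log (opNorm h) ≤ Real.log (opNorm (g * h)) := by
  rw [← Real.log_mul (lowNorm_pos g).ne' (opNorm_pos h).ne']
  exact Real.log_le_log (mul_pos (lowNorm_pos g) (opNorm_pos h)) (le_opNorm_mul g h)

lemma osc_mul_le (g h : G d) : osc (g * h) ≤ osc g + osc h := by
  have := log_opNorm_mul_le g h
  have := le_log_lowNorm_mul g h
  unfold osc; linarith

lemma logN_mul_le (g h : G d) : logN (g * h) ≤ logN g + logN h := by
  rw [logN_eq (g * h)]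
  have := log_opNorm_mul_le g h
  have := le_log_lowNorm_mul g h
  have := log_opNorm_le_logN g
  have := neg_logN_le g
  have := log_opNorm_le_logN h
  have := neg_logN_le h
  exact max_le (by linarith) (by linarith)

lemma opNorm_one_and_lowNorm_one : opNorm (1 : G d) = 1 ∧ lowNorm (1 : G d) = 1 := by
  have h : ∀ j, colSum (1 : G d) j = 1 := fun j => by simp [colSum, Matrix.one_apply]
  obtain ⟨j, hj⟩ := exists_opNorm_eq (1 : G d)
  obtain ⟨k, hk⟩ := exists_lowNorm_eq (1 : G d)
  exact ⟨hj.trans (h j), hk.trans (h k)⟩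

lemma logN_one : logN (1 : G d) = 0 := by simp [logN_eq, opNorm_one_and_lowNorm_one]

lemma l1Norm_mulVec_pos (g : G d) (x : simplex d) : 0 < l1Norm (g.1.mulVec x.1) := by
  have := lowNorm_le_mulVec g x.2.2
  rw [sum_simplex, mul_one] at this
  exact (lowNorm_pos g).trans_le this

lemma log_lowNorm_le_cocycle (g : G d) (x : simplex d) :
    Real.log (lowNorm g) ≤ cocycle g x := by
  have := lowNorm_le_mulVec g x.2.2
  rw [sum_simplex, mul_one] at this
  exact Real.log_le_log (lowNorm_pos g) this

lemma cocycle_le_log_opNorm (g : G d) (x : simplex d) :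
    cocycle g x ≤ Real.log (opNorm g) := by
  have := mulVec_le_opNorm g x.2.2
  rw [sum_simplex, mul_one] at this
  exact Real.log_le_log (l1Norm_mulVec_pos g x) this

lemma abs_cocycle_le (g : G d) (x : simplex d) : |cocycle g x| ≤ logN g :=
  abs_le.2 ⟨(neg_logN_le g).trans (log_lowNorm_le_cocycle g x),
    (cocycle_le_log_opNorm g x).trans (log_opNorm_le_logN g)⟩

lemma exists_log_opNorm_eq (g : G d) : ∃ j, Real.log (opNorm g) = cocycle g (vertex j) := by
  obtain ⟨j, hj⟩ := exists_opNorm_eq g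
  exact ⟨j, by rw [cocycle, l1Norm_mulVec_vertex, hj]⟩

omit [NeZero d] in
lemma cocycle_vertex (g : G d) (j : Fin d) : cocycle g (vertex j) = Real.log (colSum g j) := by
  rw [cocycle, l1Norm_mulVec_vertex]

/-- The projective action of `G` on the simplex. -/
def act (g : G d) (x : simplex d) : simplex d :=
  ⟨(l1Norm (g.1.mulVec x.1))⁻¹ • g.1.mulVec x.1, by
    have h : ∀ i, 0 ≤ ((l1Norm (g.1.mulVec x.1))⁻¹ • g.1.mulVec x.1) i := fun i =>
      mul_nonneg (inv_nonneg.2 (l1Norm_mulVec_pos g x).le) (mulVec_nonneg g x.2.2 i)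
    refine ⟨?_, h⟩
    rw [l1Norm_of_nonneg h]
    simp only [Pi.smul_apply, smul_eq_mul, ← Finset.mul_sum]
    rw [← l1Norm_of_nonneg (mulVec_nonneg g x.2.2), inv_mul_cancel₀ (l1Norm_mulVec_pos g x).ne']⟩

omit [NeZero d] in
lemma l1Norm_smul {c : ℝ} (hc : 0 ≤ c) (x : Fin d → ℝ) : l1Norm (c • x) = c * l1Norm x := by
  simp [l1Norm, abs_mul, abs_of_nonneg hc, Finset.mul_sum]

lemma l1Norm_mul_mulVec (g h : G d) (x : simplex d) :
    l1Norm ((g * h).1.mulVec x.1) =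
      l1Norm (h.1.mulVec x.1) * l1Norm (g.1.mulVec (act h x).1) := by
  have hp := l1Norm_mulVec_pos h x
  rw [act, Matrix.mulVec_smul, l1Norm_smul (inv_nonneg.2 hp.le), ← mul_assoc,
    mul_inv_cancel₀ hp.ne', one_mul, Matrix.mulVec_mulVec, Submonoid.coe_mul]

lemma cocycle_mul (g h : G d) (x : simplex d) :
    cocycle (g * h) x = cocycle g (act h x) + cocycle h x := by
  rw [cocycle, l1Norm_mul_mulVec, Real.log_mul (l1Norm_mulVec_pos h x).ne'
    (l1Norm_mulVec_pos g _).ne', add_comm]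
  rfl

lemma act_mul (g h : G d) (x : simplex d) : act (g * h) x = act g (act h x) := by
  apply Subtype.ext
  have hp := l1Norm_mulVec_pos h x
  change (l1Norm ((g * h).1.mulVec x.1))⁻¹ • (g * h).1.mulVec x.1 =
    (l1Norm (g.1.mulVec (act h x).1))⁻¹ • g.1.mulVec (act h x).1
  rw [l1Norm_mul_mulVec, mul_inv, Submonoid.coe_mul, ← Matrix.mulVec_mulVec]
  have h2 : g.1.mulVec (act h x).1 =
      (l1Norm (h.1.mulVec x.1))⁻¹ • g.1.mulVec (h.1.mulVec x.1) := Matrix.mulVec_smul _ _ _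
  rw [mul_comm, mul_smul, ← h2]

omit [NeZero d] in
lemma cocycle_one (x : simplex d) : cocycle (1 : G d) x = 0 := by
  simp [cocycle, x.2.1]

lemma act_one (x : simplex d) : act (1 : G d) x = x := by
  apply Subtype.ext
  simp [act, x.2.1]

/-! ### The effect of a factor with bounded entries -/

/-- The matrices all of whose entries lie in `[1 / M, M]`. -/
def entriesBounded (d : ℕ) (M : ℝ) : Set (G d) := {g | ∀ i j, M⁻¹ ≤ g.1 i j ∧ g.1 i j ≤ M}

/-- All column sums of `B * Z` lie in `[S / M, S * M]`, where `S` is the sum of all entries of `B`,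
so `B` cancels from their ratio. -/
lemma osc_mul_le_of_entriesBounded {M : ℝ} (hM : 0 < M) {Z : G d} (hZ : Z ∈ entriesBounded d M)
    (B : G d) : osc (B * Z) ≤ 2 * Real.log M := by
  set S := ∑ k, colSum B k
  have hS : 0 < S := Finset.sum_pos (fun k _ => colSum_pos B k) ⟨0, Finset.mem_univ _⟩
  have h1 : opNorm (B * Z) ≤ S * M := by
    obtain ⟨j, hj⟩ := exists_opNorm_eq (B * Z)
    rw [hj, colSum_mul, Finset.sum_mul]
    exact Finset.sum_le_sum fun k _ => mul_le_mul_of_nonneg_left (hZ k j).2 (colSum_pos B k).le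
  have h2 : S * M⁻¹ ≤ lowNorm (B * Z) := by
    obtain ⟨j, hj⟩ := exists_lowNorm_eq (B * Z)
    rw [hj, colSum_mul, Finset.sum_mul]
    exact Finset.sum_le_sum fun k _ => mul_le_mul_of_nonneg_left (hZ k j).1 (colSum_pos B k).le
  have h3 := Real.log_le_log (opNorm_pos _) h1
  have h4 := Real.log_le_log (mul_pos hS (inv_pos.2 hM)) h2
  rw [Real.log_mul hS.ne' hM.ne'] at h3
  rw [Real.log_mul hS.ne' (inv_pos.2 hM).ne', Real.log_inv] at h4
  unfold osc; linarith

/-- Each entry of `g` is comparable, up to the factor `exp x`, to the sum of its column. -/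
def ColBalanced (g : G d) (x : ℝ) : Prop := ∀ i j, colSum g j ≤ Real.exp x * g.1 i j

/-- A bounded factor on the left erases the past: entries in column `j` are at least `M⁻¹ * colSum h
j`, whereas the whole column sums to at most `d * M * colSum h j`. -/
lemma colBalanced_mul_of_entriesBounded {M : ℝ} (hM : 0 < M) {Z : G d}
    (hZ : Z ∈ entriesBounded d M) (h : G d) :
    ColBalanced (Z * h) (Real.log (d * M * M)) := by
  have hd : (0 : ℝ) < d := by exact_mod_cast Nat.pos_of_ne_zero (NeZero.ne d)
  intro i j
  rw [Real.exp_log (by positivity)]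
  have h1 : colSum (Z * h) j ≤ d * M * colSum h j := by
    rw [colSum_mul, colSum, Finset.mul_sum]
    refine Finset.sum_le_sum fun k _ => mul_le_mul_of_nonneg_right ?_ (h.2.1 k j)
    calc colSum Z k ≤ ∑ _i : Fin d, M := Finset.sum_le_sum fun i _ => (hZ i k).2
      _ = d * M := by simp
  have h2 : M⁻¹ * colSum h j ≤ (Z * h).1 i j := by
    rw [Submonoid.coe_mul, Matrix.mul_apply, colSum, Finset.mul_sum]
    exact Finset.sum_le_sum fun k _ => mul_le_mul_of_nonneg_right (hZ i k).1 (h.2.1 k j)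
  calc colSum (Z * h) j ≤ d * M * colSum h j := h1
    _ = d * M * M * (M⁻¹ * colSum h j) := by field_simp
    _ ≤ _ := mul_le_mul_of_nonneg_left h2 (by positivity)

/-- `log N(g) + log N(gᵗ)`. -/
def logNN (g : G d) : ℝ := logN g + logN (transpose g)

lemma logNN_nonneg (g : G d) : 0 ≤ logNN g := add_nonneg (logN_nonneg _) (logN_nonneg _)

omit [NeZero d] in
lemma transpose_mul (g h : G d) : transpose (g * h) = transpose h * transpose g :=
  Subtype.ext (Matrix.transpose_mul g.1 h.1)

lemma logNN_mul_le (g h : G d) : logNN (g * h) ≤ logNN g + logNN h := by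
  have h1 := logN_mul_le g h
  have h2 := logN_mul_le (transpose h) (transpose g)
  rw [← transpose_mul] at h2
  unfold logNN; linarith

/-- A row of `Z` averages the entries of a column of `h` with total weight a row sum of `Z`, which
is at least `v(Zᵗ)`; the column sum grows at most by `‖Z‖`. The loss is thus paid by `log N(Z)` and
`log N(Zᵗ)` together. -/
lemma ColBalanced.mul {h : G d} {y : ℝ} (hh : ColBalanced h y) (Z : G d) :
    ColBalanced (Z * h) (logNN Z + y) := by
  intro i j
  have hc := colSum_pos h j
  have hop : opNorm Z ≤ Real.exp (logN Z) := by
    rw [← Real.log_le_iff_le_exp (opNorm_pos Z)]; exact log_opNorm_le_logN Z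
  have hlow : 1 ≤ Real.exp (logN (transpose Z)) * lowNorm (transpose Z) := by
    have := neg_logN_le (transpose Z)
    rw [Real.le_log_iff_exp_le (lowNorm_pos _), Real.exp_neg] at this
    rwa [← inv_le_iff_one_le_mul₀' (Real.exp_pos _)]
  have h2 : lowNorm (transpose Z) * colSum h j ≤ Real.exp y * (Z * h).1 i j := by
    calc lowNorm (transpose Z) * colSum h j ≤ (∑ k, Z.1 i k) * colSum h j :=
          mul_le_mul_of_nonneg_right (lowNorm_le_colSum (transpose Z) i) hc.le
      _ ≤ Real.exp y * (Z * h).1 i j := by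
          rw [Submonoid.coe_mul, Matrix.mul_apply, Finset.sum_mul, Finset.mul_sum]
          refine Finset.sum_le_sum fun k _ => ?_
          calc Z.1 i k * colSum h j ≤ Z.1 i k * (Real.exp y * h.1 k j) :=
                mul_le_mul_of_nonneg_left (hh k j) (Z.2.1 i k)
            _ = _ := by ring
  calc colSum (Z * h) j ≤ opNorm Z * colSum h j := colSum_mul_le Z h j
    _ ≤ Real.exp (logN Z) * colSum h j := mul_le_mul_of_nonneg_right hop hc.le
    _ ≤ Real.exp (logN Z) * ((Real.exp (logN (transpose Z)) * lowNorm (transpose Z))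
          * colSum h j) := by
        gcongr; exact le_mul_of_one_le_left hc.le hlow
    _ = Real.exp (logN Z) * Real.exp (logN (transpose Z)) *
          (lowNorm (transpose Z) * colSum h j) := by ring
    _ ≤ Real.exp (logN Z) * Real.exp (logN (transpose Z)) * (Real.exp y * (Z * h).1 i j) := by
        gcongr
    _ = Real.exp (logNN Z + y) * (Z * h).1 i j := by
        rw [Real.exp_add, logNN, Real.exp_add]; ring

omit [NeZero d] in
lemma ColBalanced.mono {h : G d} {x y : ℝ} (hh : ColBalanced h x) (hxy : x ≤ y) :
    ColBalanced h y := fun i j =>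
  (hh i j).trans (mul_le_mul_of_nonneg_right (Real.exp_le_exp.2 hxy) (h.2.1 i j))

end PosMat

/-! ### Chains driven by independent innovations -/

namespace RandomChain

variable {E S Ω : Type*} [MeasurableSpace E] [MeasurableSpace S]

/-- The chain `X₀ = x₀`, `Xₙ₊₁ = T n (Yₙ, Xₙ)` driven by the sequence `Y`. -/
def chain (T : ℕ → E → S → S) (x₀ : S) (Y : ℕ → Ω → E) : ℕ → Ω → S
  | 0 => fun _ => x₀
  | n + 1 => fun ω => T n (Y n ω) (chain T x₀ Y n ω)

variable {T : ℕ → E → S → S} (hT : ∀ n, Measurable (Function.uncurry (T n))) (x₀ : S)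
  {Y : ℕ → Ω → E}

include hT in
-- The state at time `n` only involves `Y i` with `i < n`; its independence from `Y n` rests on
-- this.
lemma measurable_chain_iSup (n : ℕ) :
    Measurable[⨆ i ∈ Set.Iio n, MeasurableSpace.comap (Y i) inferInstance] (chain T x₀ Y n) := by
  induction n with
  | zero => exact measurable_const
  | succ n ih =>
    have h1 : Measurable[⨆ i ∈ Set.Iio (n + 1), MeasurableSpace.comap (Y i) inferInstance]
        (chain T x₀ Y n) :=
      ih.mono (biSup_mono fun i hi => lt_trans hi (Nat.lt_succ_self n)) le_rfl
    have h2 : Measurable[⨆ i ∈ Set.Iio (n + 1), MeasurableSpace.comap (Y i) inferInstance]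
        (Y n) :=
      (comap_measurable (Y n)).mono
        (le_iSup₂_of_le (f := fun i (_ : i ∈ Set.Iio (n + 1)) =>
          MeasurableSpace.comap (Y i) inferInstance) n (Nat.lt_succ_self n) le_rfl) le_rfl
    exact (hT n).comp (h2.prodMk h1)

variable [MeasurableSpace Ω] (hY : ∀ n, Measurable (Y n))

include hT hY in
lemma measurable_chain (n : ℕ) : Measurable (chain T x₀ Y n) :=
  (measurable_chain_iSup hT x₀ n).mono (iSup₂_le fun i _ => (hY i).comap_le) le_rfl

variable {P : Measure Ω} {μ : Measure E}

include hT hY in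
lemma indepFun_chain (hind : iIndepFun Y P) (n : ℕ) : IndepFun (Y n) (chain T x₀ Y n) P := by
  have h := indep_iSup_of_disjoint (m := fun i => MeasurableSpace.comap (Y i) inferInstance)
    (fun i => (hY i).comap_le) hind.iIndep (S := {n}) (T := Set.Iio n)
    (Set.disjoint_singleton_left.2 (by simp))
  rw [IndepFun_iff_Indep]
  refine indep_of_indep_of_le_left (indep_of_indep_of_le_right h ?_) ?_
  · exact (measurable_chain_iSup hT x₀ n).comap_le
  · simp

include hT hY in
-- The Markov property in integrated form: the joint law of `Y n` and the current state is a
-- product, so the innovation can be integrated first.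
lemma lintegral_chain [IsFiniteMeasure P] [SFinite μ] (hind : iIndepFun Y P)
    (hlaw : ∀ n, P.map (Y n) = μ) (n : ℕ) {f : E → S → ℝ≥0∞} (hf : Measurable (Function.uncurry f)) :
    ∫⁻ ω, f (Y n ω) (chain T x₀ Y n ω) ∂P =
      ∫⁻ ω, ∫⁻ g, f g (chain T x₀ Y n ω) ∂μ ∂P := by
  have hX := measurable_chain hT x₀ hY n
  have h := (indepFun_iff_map_prod_eq_prod_map_map (hY n).aemeasurable hX.aemeasurable).1
    (indepFun_chain hT x₀ hY hind n)
  rw [hlaw n] at h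
  have h1 := lintegral_map (μ := P) hf ((hY n).prodMk hX)
  simp only [Function.uncurry] at h1
  rw [← h1, h]
  exact (lintegral_prod_symm' _ hf).trans <| lintegral_map
    (f := fun y => ∫⁻ x, Function.uncurry f (x, y) ∂μ) hf.lintegral_prod_left' hX

end RandomChain

/-! ### Measurability and convolution powers -/

namespace PosMat

variable {d : ℕ}

instance : SecondCountableTopology (G d) :=
  haveI : SecondCountableTopology (Matrix (Fin d) (Fin d) ℝ) :=
    inferInstanceAs (SecondCountableTopology (Fin d → Fin d → ℝ))
  TopologicalSpace.Subtype.secondCountableTopology _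

lemma measurable_entry (i j : Fin d) : Measurable fun g : G d => g.1 i j :=
  (continuous_subtype_val.matrix_elem i j).measurable

lemma measurable_colSum (j : Fin d) : Measurable fun g : G d => colSum g j :=
  Finset.measurable_sum _ fun i _ => measurable_entry i j

lemma measurable_transpose : Measurable (transpose : G d → G d) :=
  (Continuous.subtype_mk continuous_subtype_val.matrix_transpose _).measurable

section

variable [NeZero d]

lemma measurable_opNorm : Measurable (opNorm : G d → ℝ) := by
  simp only [funext opNorm_eq_iSup]
  exact Measurable.iSup measurable_colSum

lemma measurable_lowNorm : Measurable (lowNorm : G d → ℝ) := by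
  simp only [funext lowNorm_eq_iInf]
  exact Measurable.iInf measurable_colSum

lemma measurable_logN : Measurable (logN : G d → ℝ) := by
  simp only [funext logN_eq]
  exact measurable_opNorm.log.max measurable_lowNorm.log.neg

lemma measurable_osc : Measurable (osc : G d → ℝ) :=
  measurable_opNorm.log.sub measurable_lowNorm.log

lemma measurable_logNN : Measurable (logNN : G d → ℝ) :=
  measurable_logN.add (measurable_logN.comp measurable_transpose)

end

lemma measurable_mulVec (i : Fin d) :
    Measurable fun z : G d × simplex d => z.1.1.mulVec z.2.1 i := by
  simp only [Matrix.mulVec, dotProduct]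
  exact Finset.measurable_sum _ fun j _ => ((measurable_entry i j).comp measurable_fst).mul
    ((measurable_pi_apply j).comp (measurable_subtype_coe.comp measurable_snd))

lemma measurable_l1Norm_mulVec :
    Measurable fun z : G d × simplex d => l1Norm (z.1.1.mulVec z.2.1) :=
  Finset.measurable_sum _ fun i _ => (measurable_mulVec i).abs

lemma measurable_cocycle : Measurable fun z : G d × simplex d => cocycle z.1 z.2 :=
  measurable_l1Norm_mulVec.log

lemma measurable_cocycle_left (x : simplex d) : Measurable fun g : G d => cocycle g x := by
  have h : Measurable (Function.uncurry (cocycle (d := d))) := measurable_cocycle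
  exact h.of_uncurry_right

lemma measurable_act [NeZero d] : Measurable fun z : G d × simplex d => act z.1 z.2 :=
  (measurable_pi_lambda _ fun i =>
    measurable_l1Norm_mulVec.inv.mul (measurable_mulVec i)).subtype_mk

lemma measurableSet_entriesBounded (M : ℝ) : MeasurableSet (entriesBounded d M) := by
  simp only [entriesBounded, Set.ofPred_forall]
  exact MeasurableSet.iInter fun i => MeasurableSet.iInter fun j =>
    (measurableSet_le measurable_const (measurable_entry i j)).inter
      (measurableSet_le (measurable_entry i j) measurable_const)

lemma measurableSet_colBalanced (x : ℝ) : MeasurableSet {g : G d | ColBalanced g x} := by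
  simp only [ColBalanced, Set.ofPred_forall]
  exact MeasurableSet.iInter fun i => MeasurableSet.iInter fun j =>
    measurableSet_le (measurable_colSum j) ((measurable_entry i j).const_mul _)

instance isProbabilityMeasure_convPow (μ : Measure (G d)) [IsProbabilityMeasure μ] (n : ℕ) :
    IsProbabilityMeasure (convPow μ n) := by
  induction n with
  | zero => rw [convPow]; infer_instance
  | succ n ih => rw [convPow]; infer_instance

variable (μ : Measure (G d)) [IsProbabilityMeasure μ]

lemma convPow_one : convPow μ 1 = μ := by simp [convPow]

lemma convPow_add (m n : ℕ) : convPow μ (m + n) = Measure.mconv (convPow μ m) (convPow μ n) := by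
  induction m with
  | zero => simp [convPow]
  | succ m ih =>
    rw [Nat.add_right_comm, convPow, ih, convPow, Measure.mconv_assoc]

lemma lintegral_convPow_add (m n : ℕ) {f : G d → ℝ≥0∞} (hf : Measurable f) :
    ∫⁻ g, f g ∂(convPow μ (m + n)) =
      ∫⁻ g, ∫⁻ h, f (g * h) ∂(convPow μ n) ∂(convPow μ m) := by
  rw [convPow_add, Measure.lintegral_mconv hf]

/-- `G⁺` is the countable union of the sets with entries in `[1 / (n + 1), n + 1]`, so one of them
is charged as soon as `G⁺` is. -/
lemma StrictlyContracting.exists_entriesBounded {μ : Measure (G d)}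
    (h : StrictlyContracting μ) :
    ∃ r : ℕ, 1 ≤ r ∧ ∃ M : ℝ, 1 ≤ M ∧ 0 < convPow μ r (entriesBounded d M) := by
  obtain ⟨r, hr, hpos⟩ := h
  refine ⟨r, hr, ?_⟩
  by_contra! hcon
  have h0 : convPow μ r (⋃ n : ℕ, entriesBounded d (n + 1)) = 0 :=
    measure_iUnion_null fun n => le_antisymm (hcon (n + 1) (by simp)) zero_le
  refine hpos.ne' (measure_mono_null (fun g hg => ?_) h0)
  have hev : ∀ᶠ n : ℕ in atTop, ∀ i j, ((n : ℝ) + 1)⁻¹ ≤ g.1 i j ∧ g.1 i j ≤ (n : ℝ) + 1 := by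
    simp only [eventually_all]
    intro i j
    have ht : Tendsto (fun n : ℕ => (n : ℝ) + 1) atTop atTop :=
      tendsto_atTop_add_const_right _ _ tendsto_natCast_atTop_atTop
    exact ((ht.inv_tendsto_atTop.eventually (ge_mem_nhds (hg i j)))).and
      (ht.eventually_ge_atTop _)
  obtain ⟨n, hn⟩ := hev.exists
  exact Set.mem_iUnion.2 ⟨n, hn⟩

lemma add_rpow_le {a b p : ℝ} (ha : 0 ≤ a) (hb : 0 ≤ b) (hp : 0 ≤ p) :
    (a + b) ^ p ≤ 2 ^ p * (a ^ p + b ^ p) := by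
  have hap := Real.rpow_nonneg ha p
  have hbp := Real.rpow_nonneg hb p
  calc (a + b) ^ p ≤ (2 * max a b) ^ p := by
        refine Real.rpow_le_rpow (add_nonneg ha hb) ?_ hp
        have := le_max_left a b
        have := le_max_right a b
        linarith
    _ = 2 ^ p * max a b ^ p := Real.mul_rpow (by norm_num) (ha.trans (le_max_left _ _))
    _ ≤ _ := by
        gcongr
        rcases max_choice a b with h | h <;> rw [h] <;> linarith

/-- Subadditivity of `w` propagates moments from `μ` to its powers. It serves for both `logN` and
`logNN`. -/
lemma lintegral_rpow_convPow_lt_top {w : G d → ℝ} (hw : Measurable w) (h0 : ∀ g, 0 ≤ w g)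
    (hmul : ∀ g h, w (g * h) ≤ w g + w h) {p : ℝ} (hp : 0 ≤ p)
    (hfin : ∫⁻ g, ENNReal.ofReal (w g ^ p) ∂μ < ∞) (n : ℕ) :
    ∫⁻ g, ENNReal.ofReal (w g ^ p) ∂(convPow μ n) < ∞ := by
  have hm : Measurable fun g => ENNReal.ofReal (w g ^ p) := (hw.pow_const p).ennreal_ofReal
  induction n with
  | zero =>
    rw [convPow, lintegral_dirac' _ hm]
    exact ENNReal.ofReal_lt_top
  | succ n ih =>
    rw [convPow, Measure.lintegral_mconv hm]
    calc ∫⁻ g, ∫⁻ h, ENNReal.ofReal (w (g * h) ^ p) ∂(convPow μ n) ∂μ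
        ≤ ∫⁻ g, ∫⁻ h, ENNReal.ofReal (2 ^ p) *
            (ENNReal.ofReal (w g ^ p) + ENNReal.ofReal (w h ^ p)) ∂(convPow μ n) ∂μ := by
          refine lintegral_mono fun g => lintegral_mono fun h => ?_
          have hg := Real.rpow_nonneg (h0 g) p
          have hh := Real.rpow_nonneg (h0 h) p
          rw [← ENNReal.ofReal_add hg hh, ← ENNReal.ofReal_mul (by positivity)]
          exact ENNReal.ofReal_le_ofReal ((Real.rpow_le_rpow (h0 _) (hmul g h) hp).trans
            (add_rpow_le (h0 g) (h0 h) hp))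
      _ = ENNReal.ofReal (2 ^ p) * (∫⁻ g, ENNReal.ofReal (w g ^ p) ∂μ +
            ∫⁻ h, ENNReal.ofReal (w h ^ p) ∂(convPow μ n)) := by
          have : ∀ g, ∫⁻ h, ENNReal.ofReal (2 ^ p) *
              (ENNReal.ofReal (w g ^ p) + ENNReal.ofReal (w h ^ p)) ∂(convPow μ n) =
              ENNReal.ofReal (2 ^ p) * (ENNReal.ofReal (w g ^ p) +
                ∫⁻ h, ENNReal.ofReal (w h ^ p) ∂(convPow μ n)) := fun g => by
            rw [lintegral_const_mul _ (hm.const_add _), lintegral_add_left measurable_const]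
            simp
          simp only [this]
          rw [lintegral_const_mul _ (hm.add_const _), lintegral_add_left hm]
          simp
      _ < ∞ := ENNReal.mul_lt_top ENNReal.ofReal_lt_top (ENNReal.add_lt_top.2 ⟨hfin, ih⟩)

section LeftProd

variable {Ω : Type*} {Y : ℕ → Ω → G d}

lemma leftProd_eq_chain (n : ℕ) :
    leftProd Y n = RandomChain.chain (fun _ g h => g * h) 1 Y n := by
  induction n with
  | zero => rfl
  | succ n ih => simp only [leftProd, RandomChain.chain, ih]

variable [MeasurableSpace Ω] {P : Measure Ω} [IsProbabilityMeasure P]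
  (hY : ∀ n, Measurable (Y n))

include hY in
lemma measurable_leftProd (n : ℕ) : Measurable (leftProd Y n) := by
  rw [leftProd_eq_chain]
  exact RandomChain.measurable_chain (fun _ => measurable_mul) 1 hY n

include hY in
lemma map_leftProd {ν : Measure (G d)} (hind : iIndepFun Y P) (hlaw : ∀ n, P.map (Y n) = ν)
    (n : ℕ) : P.map (leftProd Y n) = convPow ν n := by
  induction n with
  | zero => simp [leftProd, convPow]
  | succ n ih =>
    have h := RandomChain.indepFun_chain (T := fun _ g h => g * h) (fun _ => measurable_mul)
      (1 : G d) hY hind n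
    rw [← leftProd_eq_chain] at h
    have h2 := h.map_mul_eq_map_mconv_map (hY n) (measurable_leftProd hY n)
    rw [hlaw, ih] at h2
    exact h2

end LeftProd

end PosMat

/-! ### Bounded mean oscillation and the Doob increments -/

namespace PosMat

variable {d : ℕ} [NeZero d] {μ : Measure (G d)} [IsProbabilityMeasure μ]

lemma HasMoment.integrable_logN {p : ℝ} (hp : 1 ≤ p) (h : HasMoment μ p) : Integrable logN μ := by
  refine ⟨measurable_logN.aestronglyMeasurable, ?_⟩
  rw [hasFiniteIntegral_iff_ofReal (ae_of_all _ logN_nonneg)]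
  calc ∫⁻ g, ENNReal.ofReal (logN g) ∂μ
      ≤ ∫⁻ g, (1 + ENNReal.ofReal (logN g ^ p)) ∂μ := by
        refine lintegral_mono fun g => ?_
        rw [← ENNReal.ofReal_one, ← ENNReal.ofReal_add zero_le_one
          (Real.rpow_nonneg (logN_nonneg g) p)]
        refine ENNReal.ofReal_le_ofReal ?_
        rcases le_total (logN g) 1 with h1 | h1
        · have := Real.rpow_nonneg (logN_nonneg g) p
          linarith
        · have := Real.rpow_le_rpow_of_exponent_le h1 hp
          rw [Real.rpow_one] at this
          linarith
    _ = 1 + ∫⁻ g, ENNReal.ofReal (logN g ^ p) ∂μ := by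
        rw [lintegral_add_left measurable_const]; simp
    _ < ∞ := ENNReal.add_lt_top.2 ⟨ENNReal.one_lt_top, h⟩

lemma integrable_logN_convPow (h : Integrable logN μ) (n : ℕ) :
    Integrable logN (convPow μ n) := by
  refine ⟨measurable_logN.aestronglyMeasurable, ?_⟩
  rw [hasFiniteIntegral_iff_ofReal (ae_of_all _ logN_nonneg)]
  have h1 := (hasFiniteIntegral_iff_ofReal (ae_of_all _ logN_nonneg)).1 h.2
  have := lintegral_rpow_convPow_lt_top μ measurable_logN logN_nonneg logN_mul_le zero_le_one
    (by simpa using h1) n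
  simpa using this

lemma integrable_osc_convPow (h : Integrable logN μ) (n : ℕ) : Integrable osc (convPow μ n) :=
  ((integrable_logN_convPow h n).const_mul 2).mono' measurable_osc.aestronglyMeasurable
    (ae_of_all _ fun g => by
      rw [Real.norm_eq_abs, abs_of_nonneg (osc_nonneg g)]; exact osc_le g)

lemma integrable_log_opNorm_convPow (h : Integrable logN μ) (n : ℕ) :
    Integrable (fun g => Real.log (opNorm g)) (convPow μ n) :=
  (integrable_logN_convPow h n).mono' measurable_opNorm.log.aestronglyMeasurable
    (ae_of_all _ abs_log_opNorm_le)

lemma integrable_cocycle_convPow (h : Integrable logN μ) (n : ℕ) (x : simplex d) :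
    Integrable (fun g => cocycle g x) (convPow μ n) :=
  (integrable_logN_convPow h n).mono'
    (measurable_cocycle_left x).aestronglyMeasurable
    (ae_of_all _ fun g => abs_cocycle_le g x)

/-- Write a product of `m + r` factors as `B * Z`, with `Z` the rightmost block of length `r`. With
`q < 1` the probability that `Z` has an entry outside `[1/M, M]`, independence gives the contracting
recursion `e (m + r) ≤ a + q * e m` for the mean oscillations `e`. -/
lemma exists_integral_osc_le (hμ : StrictlyContracting μ) (h : Integrable logN μ) :
    ∃ C, 0 ≤ C ∧ ∀ n, ∫ g, osc g ∂(convPow μ n) ≤ C := by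
  obtain ⟨r, hr, M, hM, hpos⟩ := hμ.exists_entriesBounded
  set K := entriesBounded d M
  have hK : MeasurableSet K := measurableSet_entriesBounded M
  have hM0 : 0 < M := zero_lt_one.trans_le hM
  set e : ℕ → ℝ≥0∞ := fun n => ∫⁻ g, ENNReal.ofReal (osc g) ∂(convPow μ n)
  have hme : Measurable fun g : G d => ENNReal.ofReal (osc g) := measurable_osc.ennreal_ofReal
  have he : ∀ n, e n ≠ ∞ := fun n => (lt_top_iff_ne_top.1 <|
    (hasFiniteIntegral_iff_ofReal (ae_of_all _ osc_nonneg)).1 (integrable_osc_convPow h n).2)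
  set a : ℝ≥0∞ := ENNReal.ofReal (2 * Real.log M) + e r
  have ha : a ≠ ∞ := ENNReal.add_ne_top.2 ⟨ENNReal.ofReal_ne_top, he r⟩
  set q := convPow μ r Kᶜ
  have hq : q < 1 := by
    rw [show q = 1 - convPow μ r K from prob_compl_eq_one_sub hK]
    exact ENNReal.sub_lt_self ENNReal.one_ne_top one_ne_zero hpos.ne'
  have hrec : ∀ m, e (m + r) ≤ a + q * e m := by
    intro m
    simp only [e]
    rw [lintegral_convPow_add μ m r hme]
    calc ∫⁻ B, ∫⁻ Z, ENNReal.ofReal (osc (B * Z)) ∂(convPow μ r) ∂(convPow μ m)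
        ≤ ∫⁻ B, ∫⁻ Z, (ENNReal.ofReal (2 * Real.log M) + ENNReal.ofReal (osc Z) +
            Kᶜ.indicator (fun _ => ENNReal.ofReal (osc B)) Z) ∂(convPow μ r) ∂(convPow μ m) := by
          refine lintegral_mono fun B => lintegral_mono fun Z => ?_
          by_cases hZ : Z ∈ K
          · refine le_trans (ENNReal.ofReal_le_ofReal ?_) (le_add_right (le_add_right le_rfl))
            exact osc_mul_le_of_entriesBounded hM0 hZ B
          · rw [Set.indicator_of_mem (by exact hZ), add_assoc,
              ← ENNReal.ofReal_add (osc_nonneg Z) (osc_nonneg B)]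
            refine le_trans (ENNReal.ofReal_le_ofReal ?_) le_add_self
            linarith [osc_mul_le B Z]
      _ = ∫⁻ B, (a + q * ENNReal.ofReal (osc B)) ∂(convPow μ m) := by
          refine lintegral_congr fun B => ?_
          rw [lintegral_add_left (hme.const_add _), lintegral_add_left measurable_const,
            lintegral_indicator hK.compl]
          simp [a, e, q, mul_comm]
      _ = a + q * e m := by
          rw [lintegral_add_left measurable_const, lintegral_const_mul _ hme]; simp [e]
  -- `D` dominates the initial values `e m`, `m < r`, and satisfies `a + q * D ≤ D`, so an induction
  -- in steps of `r` closes.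
  set D : ℝ := (∑ m ∈ Finset.range r, (e m).toReal) + a.toReal / (1 - q.toReal)
  have hq1 : 0 < 1 - q.toReal := by
    have := (ENNReal.toReal_lt_toReal hq.ne_top ENNReal.one_ne_top).2 hq
    rw [ENNReal.toReal_one] at this; linarith
  have hD0 : 0 ≤ D := by positivity
  have hb0 : 0 ≤ ∑ m ∈ Finset.range r, (e m).toReal :=
    Finset.sum_nonneg fun _ _ => ENNReal.toReal_nonneg
  have hDa : a.toReal + q.toReal * D ≤ D := by
    have h1 : a.toReal = (1 - q.toReal) * (a.toReal / (1 - q.toReal)) := by field_simp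
    have h2 : (1 - q.toReal) * (a.toReal / (1 - q.toReal)) ≤ (1 - q.toReal) * D :=
      mul_le_mul_of_nonneg_left (by simp only [D]; linarith) hq1.le
    linarith
  have hbound : ∀ n, (e n).toReal ≤ D := by
    intro n
    induction n using Nat.strong_induction_on with
    | _ n ih =>
      rcases lt_or_ge n r with hn | hn
      · have h1 : (e n).toReal ≤ ∑ m ∈ Finset.range r, (e m).toReal :=
          Finset.single_le_sum (f := fun m => (e m).toReal)
            (fun _ _ => ENNReal.toReal_nonneg) (Finset.mem_range.2 hn)
        have h2 : 0 ≤ a.toReal / (1 - q.toReal) := by positivity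
        simp only [D]; linarith
      · obtain ⟨m, rfl⟩ := Nat.exists_eq_add_of_le' hn
        have h1 := ENNReal.toReal_mono (ENNReal.add_ne_top.2
          ⟨ha, ENNReal.mul_ne_top hq.ne_top (he m)⟩) (hrec m)
        rw [ENNReal.toReal_add ha (ENNReal.mul_ne_top hq.ne_top (he m)), ENNReal.toReal_mul] at h1
        have h2 := mul_le_mul_of_nonneg_left (ih m (by omega)) (ENNReal.toReal_nonneg (a := q))
        linarith
  refine ⟨D, hD0, fun n => ?_⟩
  rw [integral_eq_lintegral_of_nonneg_ae (ae_of_all _ osc_nonneg)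
    measurable_osc.aestronglyMeasurable]
  exact hbound n

variable (μ) in
/-- The mean of `log ‖g‖` under the `n`-th convolution power. -/
def meanLog (n : ℕ) : ℝ := ∫ g, Real.log (opNorm g) ∂(convPow μ n)

variable (μ) in
/-- The mean of the cocycle `σ(·, x)` under the `n`-th convolution power. -/
def meanCocycle (n : ℕ) (x : simplex d) : ℝ := ∫ g, cocycle g x ∂(convPow μ n)

omit [NeZero d] in
lemma measurable_meanCocycle (n : ℕ) : Measurable (meanCocycle μ n) := by
  have h : StronglyMeasurable (Function.uncurry fun (x : simplex d) (g : G d) => cocycle g x) :=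
    (measurable_cocycle.comp measurable_swap).stronglyMeasurable
  exact (h.integral_prod_right (ν := convPow μ n)).measurable

lemma integrable_mul_of_le {w : G d → ℝ} (hw : Measurable w) (hle : ∀ g, |w g| ≤ logN g)
    (h : Integrable logN μ) (m n : ℕ) :
    Integrable (fun z : G d × G d => w (z.1 * z.2)) ((convPow μ m).prod (convPow μ n)) := by
  refine (((integrable_logN_convPow h m).comp_fst _).add
    ((integrable_logN_convPow h n).comp_snd _)).mono'
    (hw.comp measurable_mul).aestronglyMeasurable (ae_of_all _ fun z => ?_)
  exact (hle _).trans (logN_mul_le _ _)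

omit [NeZero d] in
lemma integral_convPow_add {w : G d → ℝ} (hw : Measurable w) (m n : ℕ) :
    ∫ g, w g ∂(convPow μ (m + n)) =
      ∫ z : G d × G d, w (z.1 * z.2) ∂((convPow μ m).prod (convPow μ n)) := by
  rw [convPow_add, Measure.mconv, integral_map measurable_mul.aemeasurable
    hw.aestronglyMeasurable]

omit [IsProbabilityMeasure μ] in
lemma meanLog_zero : meanLog μ 0 = 0 := by
  rw [meanLog, convPow, integral_dirac' _ _ measurable_opNorm.log.stronglyMeasurable]
  simp [opNorm_one_and_lowNorm_one]

lemma meanLog_add_le (h : Integrable logN μ) (m n : ℕ) :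
    meanLog μ (m + n) ≤ meanLog μ m + meanLog μ n := by
  rw [meanLog, integral_convPow_add measurable_opNorm.log]
  have h1 := (integrable_log_opNorm_convPow h m).comp_fst (convPow μ n)
  have h2 := (integrable_log_opNorm_convPow h n).comp_snd (convPow μ m)
  refine (integral_mono (integrable_mul_of_le measurable_opNorm.log abs_log_opNorm_le h m n)
    (h1.add h2) fun z => log_opNorm_mul_le z.1 z.2).trans_eq ?_
  simp only [Pi.add_apply]
  rw [integral_add h1 h2, integral_fun_fst (fun g => Real.log (opNorm g)),
    integral_fun_snd (fun g => Real.log (opNorm g))]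
  simp [meanLog]

/-- Integrate `log ‖g h‖ ≥ log v(g) + log ‖h‖ = log ‖g‖ - osc g + log ‖h‖`: the defect of
superadditivity is a mean oscillation. -/
lemma le_meanLog_add (h : Integrable logN μ) {C : ℝ}
    (hC : ∀ n, ∫ g, osc g ∂(convPow μ n) ≤ C) (m n : ℕ) :
    meanLog μ m + meanLog μ n - C ≤ meanLog μ (m + n) := by
  rw [meanLog, meanLog, meanLog, integral_convPow_add measurable_opNorm.log]
  have h1 := ((integrable_log_opNorm_convPow h m).sub (integrable_osc_convPow h m)).comp_fst
    (convPow μ n)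
  have h2 := (integrable_log_opNorm_convPow h n).comp_snd (convPow μ m)
  have h3 := integral_mono (h1.add h2)
    (integrable_mul_of_le measurable_opNorm.log abs_log_opNorm_le h m n) fun z => by
      have := le_log_opNorm_mul z.1 z.2
      simp only [Pi.add_apply, Pi.sub_apply, osc]
      linarith
  simp only [Pi.add_apply] at h3
  rw [integral_add h1 h2, integral_fun_fst ((fun g => Real.log (opNorm g)) - osc),
    integral_fun_snd (fun g => Real.log (opNorm g))] at h3
  simp only [Pi.sub_apply] at h3
  rw [integral_sub (integrable_log_opNorm_convPow h m) (integrable_osc_convPow h m)] at h3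
  simp only [probReal_univ, one_smul] at h3
  linarith [hC m]

lemma abs_meanLog_le (h : Integrable logN μ) (n : ℕ) :
    |meanLog μ n| ≤ n * ∫ g, logN g ∂μ := by
  have key : ∀ n : ℕ, ∫ g, logN g ∂(convPow μ n) ≤ n * ∫ g, logN g ∂μ := by
    intro n
    induction n with
    | zero =>
      rw [convPow, integral_dirac' _ _ measurable_logN.stronglyMeasurable]
      simp [logN_one]
    | succ n ih =>
      have h1 := (integrable_logN_convPow h n).comp_fst (convPow μ 1)
      have h2 := (integrable_logN_convPow h 1).comp_snd (convPow μ n)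
      rw [integral_convPow_add measurable_logN]
      refine (integral_mono (integrable_mul_of_le measurable_logN
        (fun g => (abs_of_nonneg (logN_nonneg g)).le) h n 1)
        (h1.add h2) fun z => logN_mul_le z.1 z.2).trans ?_
      simp only [Pi.add_apply]
      rw [integral_add h1 h2, integral_fun_fst logN, integral_fun_snd logN]
      simp only [probReal_univ, one_smul, convPow_one]
      push_cast
      linarith
  calc |meanLog μ n| ≤ ∫ g, |Real.log (opNorm g)| ∂(convPow μ n) := abs_integral_le_integral_abs
    _ ≤ ∫ g, logN g ∂(convPow μ n) := integral_mono (integrable_log_opNorm_convPow h n).abs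
        (integrable_logN_convPow h n) abs_log_opNorm_le
    _ ≤ _ := key n

lemma tendsto_meanLog_div (h : Integrable logN μ) :
    Tendsto (fun n : ℕ => meanLog μ n / n) atTop (𝓝 (lyapunov μ)) := by
  have hs : Subadditive (meanLog μ) := meanLog_add_le h
  have hb : BddBelow (Set.range fun n : ℕ => meanLog μ n / n) := by
    refine ⟨-∫ g, logN g ∂μ, ?_⟩
    rintro _ ⟨n, rfl⟩
    have h0 : 0 ≤ ∫ g, logN g ∂μ := integral_nonneg logN_nonneg
    rcases Nat.eq_zero_or_pos n with rfl | hn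
    · simpa using h0
    · have := (abs_le.1 (abs_meanLog_le h n)).1
      simp only
      rw [le_div_iff₀ (by exact_mod_cast hn)]
      linarith
  have ht := hs.tendsto_lim hb
  rw [show lyapunov μ = hs.lim from ht.limUnder_eq]
  exact ht

/-- `meanLog μ` and `C - meanLog μ` are both subadditive. The limit in Fekete's lemma is an infimum,
so each of them gives one side of the bound at every `n`. -/
lemma abs_meanLog_sub_le (h : Integrable logN μ) {C : ℝ} (hC0 : 0 ≤ C)
    (hC : ∀ n, ∫ g, osc g ∂(convPow μ n) ≤ C) (n : ℕ) :
    |meanLog μ n - n * lyapunov μ| ≤ C := by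
  rcases Nat.eq_zero_or_pos n with rfl | hn
  · simpa [meanLog_zero] using hC0
  have hn' : (0 : ℝ) < n := by exact_mod_cast hn
  have ht := tendsto_meanLog_div h
  have hs : Subadditive (meanLog μ) := meanLog_add_le h
  have hs2 : Subadditive fun n => C - meanLog μ n := fun m n => by
    have := le_meanLog_add h hC m n
    simp only; linarith
  have hbd : ∀ {u : ℕ → ℝ} {l : ℝ}, Tendsto u atTop (𝓝 l) → BddBelow (Set.range u) :=
    fun hu => hu.bddBelow_range
  have h1 : lyapunov μ ≤ meanLog μ n / n := by
    rw [tendsto_nhds_unique ht (hs.tendsto_lim (hbd ht))]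
    exact hs.lim_le_div (hbd ht) hn.ne'
  have ht2 : Tendsto (fun n : ℕ => (C - meanLog μ n) / n) atTop (𝓝 (-lyapunov μ)) := by
    have := (tendsto_const_div_atTop_nhds_zero_nat C).sub ht
    simpa [sub_div] using this
  have h2 : -lyapunov μ ≤ (C - meanLog μ n) / n := by
    rw [tendsto_nhds_unique ht2 (hs2.tendsto_lim (hbd ht2))]
    exact hs2.lim_le_div (hbd ht2) hn.ne'
  rw [le_div_iff₀ hn'] at h1 h2
  exact abs_le.2 ⟨by linarith, by linarith⟩

lemma abs_meanCocycle_sub_le (h : Integrable logN μ) {C : ℝ} (hC0 : 0 ≤ C)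
    (hC : ∀ n, ∫ g, osc g ∂(convPow μ n) ≤ C) (n : ℕ) (x : simplex d) :
    |meanCocycle μ n x - n * lyapunov μ| ≤ 2 * C := by
  have h1 := abs_meanLog_sub_le h hC0 hC n
  have h2 : |meanCocycle μ n x - meanLog μ n| ≤ C := by
    rw [meanCocycle, meanLog, ← integral_sub (integrable_cocycle_convPow h n x)
      (integrable_log_opNorm_convPow h n)]
    refine (abs_integral_le_integral_abs.trans (integral_mono
      ((integrable_cocycle_convPow h n x).sub (integrable_log_opNorm_convPow h n)).abs
      (integrable_osc_convPow h n) fun g => ?_)).trans (hC n)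
    have := cocycle_le_log_opNorm g x
    have := log_lowNorm_le_cocycle g x
    have := log_lowNorm_le g
    simp only [Pi.sub_apply, osc]
    exact abs_le.2 ⟨by linarith, by linarith⟩
  rw [abs_le] at *
  constructor <;> linarith [h1.1, h1.2, h2.1, h2.2]

/-- Conditioning on the factor applied first and using the cocycle identity. This is exactly what
makes `increment` centred. -/
lemma meanCocycle_succ (h : Integrable logN μ) (n : ℕ) (x : simplex d) :
    meanCocycle μ (n + 1) x = ∫ g, (cocycle g x + meanCocycle μ n (act g x)) ∂μ := by
  have hm := measurable_cocycle_left x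
  have hi := integrable_mul_of_le hm (fun g => abs_cocycle_le g x) h n 1
  rw [meanCocycle, integral_convPow_add hm, integral_prod_symm _ hi, convPow_one]
  refine integral_congr_ae (ae_of_all _ fun g => ?_)
  simp only [cocycle_mul]
  rw [integral_add (integrable_cocycle_convPow h n _) (integrable_const _)]
  simp [meanCocycle, add_comm]

/-- The increments of the Doob martingale of the cocycle. -/
def increment (μ : Measure (G d)) (m : ℕ) (g : G d) (x : simplex d) : ℝ :=
  cocycle g x + meanCocycle μ m (act g x) - meanCocycle μ (m + 1) x

lemma measurable_increment (m : ℕ) : Measurable (Function.uncurry (increment μ m)) :=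
  (measurable_cocycle.add ((measurable_meanCocycle m).comp measurable_act)).sub
    ((measurable_meanCocycle (m + 1)).comp measurable_snd)

/-- The two means in `increment` are within `2 * C` of `m * λ` and `(m + 1) * λ`, so their
difference is at most `|λ| + 4 * C`, uniformly in the horizon and in `x`. -/
lemma abs_increment_le (h : Integrable logN μ) {C : ℝ} (hC0 : 0 ≤ C)
    (hC : ∀ n, ∫ g, osc g ∂(convPow μ n) ≤ C) (m : ℕ) (g : G d) (x : simplex d) :
    |increment μ m g x| ≤ logN g + (|lyapunov μ| + 4 * C) := by
  have h1 := abs_le.1 (abs_meanCocycle_sub_le h hC0 hC m (act g x))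
  have h2 := abs_le.1 (abs_meanCocycle_sub_le h hC0 hC (m + 1) x)
  have h3 := abs_le.1 (abs_cocycle_le g x)
  have h4 := neg_abs_le (lyapunov μ)
  have h5 := le_abs_self (lyapunov μ)
  push_cast at h2
  unfold increment
  exact abs_le.2 ⟨by linarith [h1.1, h2.2, h3.1], by linarith [h1.2, h2.1, h3.2]⟩

lemma integral_increment (h : Integrable logN μ) {C : ℝ} (hC0 : 0 ≤ C)
    (hC : ∀ n, ∫ g, osc g ∂(convPow μ n) ≤ C) (m : ℕ) (x : simplex d) :
    ∫ g, increment μ m g x ∂μ = 0 := by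
  have hi : Integrable (fun g => increment μ m g x) μ :=
    (h.add (integrable_const (|lyapunov μ| + 4 * C))).mono'
      ((measurable_increment m).comp (measurable_id.prodMk measurable_const)).aestronglyMeasurable
      (ae_of_all _ fun g => abs_increment_le h hC0 hC m g x)
  have hi2 : Integrable (fun g => cocycle g x + meanCocycle μ m (act g x)) μ := by
    have := hi.add (integrable_const (meanCocycle μ (m + 1) x))
    refine this.congr (ae_of_all _ fun g => ?_)
    simp [increment]
  simp only [increment]
  rw [integral_sub hi2 (integrable_const _), ← meanCocycle_succ h]
  simp

end PosMat

/-! ### Maximal inequalities for sums along a chain -/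

namespace RandomChain

lemma exp_le_one_add_add_sq_mul_exp_abs (u : ℝ) :
    Real.exp u ≤ 1 + u + u ^ 2 * Real.exp |u| := by
  have h := Complex.norm_exp_sub_sum_le_norm_mul_exp (u : ℂ) 2
  have h2 : Complex.exp u - ∑ m ∈ Finset.range 2, (u : ℂ) ^ m / (m.factorial : ℂ) =
      ((Real.exp u - (1 + u) : ℝ) : ℂ) := by
    simp [Finset.sum_range_succ]
  rw [h2, Complex.norm_real, Complex.norm_real, Real.norm_eq_abs, Real.norm_eq_abs, sq_abs] at h
  linarith [le_abs_self (Real.exp u - (1 + u))]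

variable {E S Ω : Type*} [MeasurableSpace E] [MeasurableSpace S] [MeasurableSpace Ω]

/-- The sums `∑_{i < n} φ i (Yᵢ, Xᵢ)` along the chain. -/
def chainSum (T : E → S → S) (φ : ℕ → E → S → ℝ) (x₀ : S) (Y : ℕ → Ω → E) (n : ℕ) (ω : Ω) : ℝ :=
  ∑ i ∈ Finset.range n, φ i (Y i ω) (chain (fun _ => T) x₀ Y i ω)

open Classical in
/-- One step of the chain that carries along the sum, frozen once it enters `A`. -/
def stoppedStep (T : E → S → S) (φ : ℕ → E → S → ℝ) (A : Set ℝ) (n : ℕ) (g : E) (z : ℝ × S) :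
    ℝ × S :=
  (if z.1 ∈ A then z.1 else z.1 + φ n g z.2, T g z.2)

variable {T : E → S → S} {φ : ℕ → E → S → ℝ} {A : Set ℝ} {x₀ : S} {Y : ℕ → Ω → E}

omit [MeasurableSpace E] [MeasurableSpace S] [MeasurableSpace Ω] in
lemma stopped_snd (n : ℕ) (ω : Ω) :
    (chain (stoppedStep T φ A) (0, x₀) Y n ω).2 = chain (fun _ => T) x₀ Y n ω := by
  induction n with
  | zero => rfl
  | succ n ih => simp only [chain, stoppedStep, ih]

omit [MeasurableSpace E] [MeasurableSpace S] [MeasurableSpace Ω] in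
-- Freezing the sum on entering `A` turns an event about the whole path into one about the terminal
-- value.
lemma stopped_fst_mem {n : ℕ} {ω : Ω} (h : ∃ k ≤ n, chainSum T φ x₀ Y k ω ∈ A) :
    (chain (stoppedStep T φ A) (0, x₀) Y n ω).1 ∈ A := by
  have key : ∀ n, (chain (stoppedStep T φ A) (0, x₀) Y n ω).1 ∈ A ∨
      ((chain (stoppedStep T φ A) (0, x₀) Y n ω).1 = chainSum T φ x₀ Y n ω ∧
        ∀ k ≤ n, chainSum T φ x₀ Y k ω ∉ A) := by
    intro n
    induction n with
    | zero =>
      by_cases h0 : (0 : ℝ) ∈ A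
      · exact Or.inl h0
      · refine Or.inr ⟨by simp [chain, chainSum], fun k hk => ?_⟩
        obtain rfl := Nat.le_zero.1 hk
        simpa [chainSum] using h0
    | succ n ih =>
      rcases ih with h1 | ⟨h1, h2⟩
      · left; simp [chain, stoppedStep, h1]
      · have h3 : (chain (stoppedStep T φ A) (0, x₀) Y (n + 1) ω).1 =
            chainSum T φ x₀ Y (n + 1) ω := by
          simp only [chain, stoppedStep]
          rw [h1, if_neg (h2 n le_rfl), stopped_snd, chainSum, chainSum, Finset.sum_range_succ]
        by_cases h4 : chainSum T φ x₀ Y (n + 1) ω ∈ A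
        · left; rwa [h3]
        · refine Or.inr ⟨h3, fun k hk => ?_⟩
          rcases Nat.of_le_succ hk with h5 | rfl
          · exact h2 k h5
          · exact h4
  rcases key n with h1 | ⟨-, h2⟩
  · exact h1
  · obtain ⟨k, hk, hA⟩ := h
    exact absurd hA (h2 k hk)

lemma measurable_stoppedStep (hT : Measurable (Function.uncurry T))
    (hφ : ∀ n, Measurable (Function.uncurry (φ n))) (hA : MeasurableSet A) (n : ℕ) :
    Measurable (Function.uncurry (stoppedStep T φ A n)) := by
  have hp : Measurable fun z : E × ℝ × S => (z.1, z.2.2) :=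
    measurable_fst.prodMk (measurable_snd.comp measurable_snd)
  have hs : Measurable fun z : E × ℝ × S => z.2.1 := measurable_fst.comp measurable_snd
  exact (Measurable.ite (hs hA) hs (hs.add ((hφ n).comp hp))).prodMk (hT.comp hp)

variable {P : Measure Ω} [IsProbabilityMeasure P] {μ : Measure E} [IsProbabilityMeasure μ]
  (hT : Measurable (Function.uncurry T)) (hφ : ∀ n, Measurable (Function.uncurry (φ n)))
  (hY : ∀ n, Measurable (Y n)) (hind : iIndepFun Y P) (hlaw : ∀ n, P.map (Y n) = μ)

include hT hφ hY hind hlaw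

/-- The condition `1 ≤ a` makes the one-step bound hold also on the frozen part, where `Ψ` does not
move. -/
lemma lintegral_stopped_succ_le (hA : MeasurableSet A) {Ψ : ℝ → ℝ≥0∞} (hΨ : Measurable Ψ)
    {a b : ℝ≥0∞} (ha : 1 ≤ a)
    (hstep : ∀ n s u, ∫⁻ g, Ψ (s + φ n g u) ∂μ ≤ a * Ψ s + b) (n : ℕ) :
    ∫⁻ ω, Ψ (chain (stoppedStep T φ A) (0, x₀) Y (n + 1) ω).1 ∂P ≤
      a * ∫⁻ ω, Ψ (chain (stoppedStep T φ A) (0, x₀) Y n ω).1 ∂P + b := by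
  have hS := measurable_stoppedStep hT hφ hA
  have hX := measurable_chain hS (0, x₀) hY n
  have h := lintegral_chain (P := P) (μ := μ) hS (0, x₀) hY hind hlaw n
    (f := fun g z => Ψ (stoppedStep T φ A n g z).1) (hΨ.comp (measurable_fst.comp (hS n)))
  simp only [chain]
  rw [h]
  calc _ ≤ ∫⁻ ω, (a * Ψ (chain (stoppedStep T φ A) (0, x₀) Y n ω).1 + b) ∂P := by
        refine lintegral_mono fun ω => ?_
        simp only [stoppedStep]
        split_ifs with hz
        · rw [lintegral_const, measure_univ, mul_one]
          exact le_add_right (le_mul_of_one_le_left' ha)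
        · exact hstep n _ _
    _ = _ := by
        have hm : Measurable fun ω => Ψ (chain (stoppedStep T φ A) (0, x₀) Y n ω).1 :=
          hΨ.comp (measurable_fst.comp hX)
        rw [lintegral_add_right _ measurable_const, lintegral_const_mul _ hm]
        simp

/-- Doob's maximal argument for a general Lyapunov function `Ψ`: `w` dominates the mean of `Ψ` along
the sum stopped at level `z`, and Markov's inequality at the terminal time concludes. The choices `Ψ
s = s ^ 2` and `Ψ s = exp (t s) + exp (-t s)` give the two inequalities below. -/
lemma measure_maximal_le {Ψ : ℝ → ℝ≥0∞} (hΨ : Measurable Ψ)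
    {a b : ℝ≥0∞} (ha : 1 ≤ a)
    (hstep : ∀ n s u, ∫⁻ g, Ψ (s + φ n g u) ∂μ ≤ a * Ψ s + b) {w : ℕ → ℝ≥0∞}
    (hw0 : Ψ 0 ≤ w 0) (hw : ∀ n, a * w n + b ≤ w (n + 1)) {z : ℝ} {c : ℝ≥0∞}
    (hc : ∀ s, z ≤ |s| → c ≤ Ψ s) (n : ℕ) :
    c * P {ω | ∃ k ≤ n, z ≤ |chainSum T φ x₀ Y k ω|} ≤ w n := by
  set A : Set ℝ := {s | z ≤ |s|}
  have hA : MeasurableSet A := measurableSet_le measurable_const measurable_id.abs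
  have h1 : ∀ n, ∫⁻ ω, Ψ (chain (stoppedStep T φ A) (0, x₀) Y n ω).1 ∂P ≤ w n := by
    intro n
    induction n with
    | zero => simpa [chain] using hw0
    | succ n ih =>
      refine (lintegral_stopped_succ_le hT hφ hY hind hlaw hA hΨ ha hstep n).trans
        (le_trans ?_ (hw n))
      gcongr
  have hX := measurable_chain (measurable_stoppedStep hT hφ hA) (0, x₀) hY n
  refine le_trans ?_ (h1 n)
  calc c * P {ω | ∃ k ≤ n, z ≤ |chainSum T φ x₀ Y k ω|}
      ≤ c * P {ω | c ≤ Ψ (chain (stoppedStep T φ A) (0, x₀) Y n ω).1} := by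
        gcongr
        exact fun h => hc _ (stopped_fst_mem (A := A) h)
    _ ≤ _ := mul_meas_ge_le_lintegral (hΨ.comp (measurable_fst.comp hX)) c

/-- Kolmogorov's maximal inequality along the chain. -/
lemma measure_maximal_sq_le {L : ℝ} (hL : ∀ n g u, |φ n g u| ≤ L)
    (hmean : ∀ n u, ∫ g, φ n g u ∂μ = 0) {V : ℝ} (hV : ∀ n u, ∫ g, φ n g u ^ 2 ∂μ ≤ V)
    {z : ℝ} (hz : 0 < z) (n : ℕ) :
    P {ω | ∃ k ≤ n, z ≤ |chainSum T φ x₀ Y k ω|} ≤ ENNReal.ofReal (n * V / z ^ 2) := by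
  have hV0 : 0 ≤ V := (integral_nonneg fun g => sq_nonneg _).trans (hV 0 x₀)
  have hi : ∀ n u, Integrable (fun g => φ n g u) μ := fun n u =>
    Integrable.of_bound (hφ n).of_uncurry_right.aestronglyMeasurable L
      (ae_of_all _ fun g => hL n g u)
  have hi2 : ∀ n u, Integrable (fun g => φ n g u ^ 2) μ := fun n u =>
    Integrable.of_bound ((hφ n).of_uncurry_right.pow_const 2).aestronglyMeasurable (L ^ 2)
      (ae_of_all _ fun g => by
        rw [Real.norm_eq_abs, abs_pow]
        exact pow_le_pow_left₀ (abs_nonneg _) (hL n g u) 2)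
  have h := measure_maximal_le (x₀ := x₀) hT hφ hY hind hlaw
    (Ψ := fun s => ENNReal.ofReal (s ^ 2)) (by fun_prop) (a := 1) (b := ENNReal.ofReal V) le_rfl
    (fun n s u => by
      have hi3 : Integrable (fun g => s ^ 2 + 2 * s * φ n g u + φ n g u ^ 2) μ :=
        ((integrable_const _).add ((hi n u).const_mul _)).add (hi2 n u)
      have h1 : ∀ g, (s + φ n g u) ^ 2 = s ^ 2 + 2 * s * φ n g u + φ n g u ^ 2 := fun g => by ring
      simp only [h1]
      rw [← ofReal_integral_eq_lintegral_ofReal hi3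
        (ae_of_all _ fun g => by simp only [Pi.zero_apply, ← h1]; positivity), one_mul,
        ← ENNReal.ofReal_add (sq_nonneg s) hV0]
      refine ENNReal.ofReal_le_ofReal ?_
      rw [integral_add (by exact (integrable_const _).add ((hi n u).const_mul _)) (hi2 n u),
        integral_add (integrable_const _) ((hi n u).const_mul _), integral_const_mul, hmean]
      simpa using hV n u)
    (w := fun n => ENNReal.ofReal (n * V)) (by simp)
    (fun n => by
      rw [one_mul, ← ENNReal.ofReal_add (by positivity) hV0]
      refine ENNReal.ofReal_le_ofReal ?_
      push_cast; linarith)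
    (z := z) (c := ENNReal.ofReal (z ^ 2))
    (fun s hs => ENNReal.ofReal_le_ofReal (by
      rw [← sq_abs s]; exact pow_le_pow_left₀ hz.le hs 2)) n
  rw [ENNReal.ofReal_div_of_pos (by positivity)]
  rw [ENNReal.le_div_iff_mul_le (by simp [hz.ne']) (by simp), mul_comm]
  exact h

/-- An exponential maximal inequality along the chain. -/
lemma measure_maximal_exp_le {L : ℝ} (hL : ∀ n g u, |φ n g u| ≤ L)
    (hmean : ∀ n u, ∫ g, φ n g u ∂μ = 0) {V : ℝ} (hV : ∀ n u, ∫ g, φ n g u ^ 2 ∂μ ≤ V)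
    {z t : ℝ} (ht : 0 ≤ t) (n : ℕ) :
    P {ω | ∃ k ≤ n, z ≤ |chainSum T φ x₀ Y k ω|} ≤
      ENNReal.ofReal (2 * Real.exp (n * (V * t ^ 2 * Real.exp (t * L)) - t * z)) := by
  have hV0 : 0 ≤ V := (integral_nonneg fun g => sq_nonneg _).trans (hV 0 x₀)
  set c : ℝ := V * t ^ 2 * Real.exp (t * L)
  have hc0 : 0 ≤ c := by positivity
  have hi : ∀ n u, Integrable (fun g => φ n g u) μ := fun n u =>
    Integrable.of_bound (hφ n).of_uncurry_right.aestronglyMeasurable L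
      (ae_of_all _ fun g => hL n g u)
  have hi2 : ∀ n u, Integrable (fun g => φ n g u ^ 2) μ := fun n u =>
    Integrable.of_bound ((hφ n).of_uncurry_right.pow_const 2).aestronglyMeasurable (L ^ 2)
      (ae_of_all _ fun g => by
        rw [Real.norm_eq_abs, abs_pow]
        exact pow_le_pow_left₀ (abs_nonneg _) (hL n g u) 2)
  -- Since `φ` is centred, integrating this bound kills the linear term and leaves the factor `1 +
  -- c` per step; both signs of `τ` are needed for the two-sided deviation.
  have hexp : ∀ τ : ℝ, |τ| = t → ∀ n g u,
      Real.exp (τ * φ n g u) ≤ 1 + τ * φ n g u + t ^ 2 * Real.exp (t * L) * φ n g u ^ 2 := by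
    intro τ hτ n g u
    refine (exp_le_one_add_add_sq_mul_exp_abs _).trans ?_
    have h1 : |τ * φ n g u| ≤ t * L := by
      rw [abs_mul, hτ]; exact mul_le_mul_of_nonneg_left (hL n g u) ht
    have h2 : (τ * φ n g u) ^ 2 * Real.exp |τ * φ n g u| ≤
        (τ * φ n g u) ^ 2 * Real.exp (t * L) :=
      mul_le_mul_of_nonneg_left (Real.exp_le_exp.2 h1) (sq_nonneg _)
    have h3 : (τ * φ n g u) ^ 2 = t ^ 2 * φ n g u ^ 2 := by rw [mul_pow, ← sq_abs τ, hτ]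
    rw [h3] at h2 ⊢
    linarith
  have h := measure_maximal_le (x₀ := x₀) hT hφ hY hind hlaw
    (Ψ := fun s => ENNReal.ofReal (Real.exp (t * s) + Real.exp (-t * s))) (by fun_prop)
    (a := ENNReal.ofReal (1 + c)) (b := 0) (by
      rw [← ENNReal.ofReal_one]; exact ENNReal.ofReal_le_ofReal (by linarith))
    (fun n s u => by
      have hj : ∀ τ : ℝ, Integrable (fun g => Real.exp (τ * s) *
          (1 + τ * φ n g u + t ^ 2 * Real.exp (t * L) * φ n g u ^ 2)) μ := fun τ =>
        (((integrable_const _).add ((hi n u).const_mul _)).add ((hi2 n u).const_mul _)).const_mul _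
      have hk : ∀ τ : ℝ, ∫ g, Real.exp (τ * s) *
          (1 + τ * φ n g u + t ^ 2 * Real.exp (t * L) * φ n g u ^ 2) ∂μ ≤
          Real.exp (τ * s) * (1 + c) := fun τ => by
        rw [integral_const_mul]
        refine mul_le_mul_of_nonneg_left ?_ (Real.exp_pos _).le
        rw [integral_add (by exact (integrable_const _).add ((hi n u).const_mul _))
          ((hi2 n u).const_mul _), integral_add (integrable_const _) ((hi n u).const_mul _),
          integral_const_mul, integral_const_mul, hmean]
        have := mul_le_mul_of_nonneg_left (hV n u)
          (show 0 ≤ t ^ 2 * Real.exp (t * L) by positivity)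
        simp only [integral_const, probReal_univ, one_smul, mul_zero, add_zero, c]
        linarith
      have h1 : ∀ g, Real.exp (t * (s + φ n g u)) + Real.exp (-t * (s + φ n g u)) ≤
          Real.exp (t * s) * (1 + t * φ n g u + t ^ 2 * Real.exp (t * L) * φ n g u ^ 2) +
          Real.exp (-t * s) *
            (1 + -t * φ n g u + t ^ 2 * Real.exp (t * L) * φ n g u ^ 2) := fun g => by
        rw [mul_add, mul_add, Real.exp_add, Real.exp_add]
        gcongr
        · exact hexp t (abs_of_nonneg ht) n g u
        · exact hexp (-t) (by rw [abs_neg, abs_of_nonneg ht]) n g u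
      calc _ ≤ ∫⁻ g, ENNReal.ofReal (Real.exp (t * s) *
            (1 + t * φ n g u + t ^ 2 * Real.exp (t * L) * φ n g u ^ 2) +
            Real.exp (-t * s) *
            (1 + -t * φ n g u + t ^ 2 * Real.exp (t * L) * φ n g u ^ 2)) ∂μ :=
              lintegral_mono fun g => ENNReal.ofReal_le_ofReal (h1 g)
        _ ≤ _ := by
          have hjj : Integrable (fun g => Real.exp (t * s) *
              (1 + t * φ n g u + t ^ 2 * Real.exp (t * L) * φ n g u ^ 2) + Real.exp (-t * s) *
              (1 + -t * φ n g u + t ^ 2 * Real.exp (t * L) * φ n g u ^ 2)) μ :=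
            (hj t).add (hj (-t))
          rw [← ofReal_integral_eq_lintegral_ofReal hjj
            (ae_of_all _ fun g => le_trans (by positivity) (h1 g)),
            integral_add (hj t) (hj (-t)), add_zero, ← ENNReal.ofReal_mul (by positivity)]
          refine ENNReal.ofReal_le_ofReal ?_
          linarith [hk t, hk (-t)])
    (w := fun n => ENNReal.ofReal (2 * (1 + c) ^ n)) (by simp [one_add_one_eq_two])
    (fun n => by
      rw [add_zero, ← ENNReal.ofReal_mul (by positivity)]
      exact ENNReal.ofReal_le_ofReal (le_of_eq (by ring)))
    (z := z) (c := ENNReal.ofReal (Real.exp (t * z)))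
    (fun s hs => ENNReal.ofReal_le_ofReal (by
      rcases abs_cases s with ⟨h1, -⟩ | ⟨h1, -⟩ <;> rw [h1] at hs
      · have := Real.exp_le_exp.2 (mul_le_mul_of_nonneg_left hs ht)
        linarith [Real.exp_pos (-t * s)]
      · have := Real.exp_le_exp.2 (mul_le_mul_of_nonneg_left hs ht)
        rw [← neg_mul_comm] at this
        linarith [Real.exp_pos (t * s)])) n
  have h2 : 2 * (1 + c) ^ n ≤ 2 * Real.exp (n * c) := by
    rw [Real.exp_nat_mul]
    gcongr
    linarith [Real.add_one_le_exp c]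
  have h3 := h.trans (ENNReal.ofReal_le_ofReal h2)
  rw [Real.exp_sub, ← mul_div_assoc, ENNReal.ofReal_div_of_pos (Real.exp_pos _),
    ENNReal.le_div_iff_mul_le (by simp [Real.exp_pos]) (by simp), mul_comm]
  exact h3

omit hT hφ hY hind hlaw

/-! ### Truncation of the increments -/

section Truncation

variable {ξ : E → ℝ} {y : ℝ}

/-- The increment `φ`, cut off where `ξ > y` and centred. -/
def truncated (μ : Measure E) (ξ : E → ℝ) (y : ℝ) (φ : ℕ → E → S → ℝ) (n : ℕ) (g : E) (u : S) :
    ℝ :=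
  {g | ξ g ≤ y}.indicator (fun g => φ n g u) g -
    ∫ g, {g | ξ g ≤ y}.indicator (fun g => φ n g u) g ∂μ

omit [MeasurableSpace E] [MeasurableSpace S] in
lemma abs_indicator_le (hφξ : ∀ n g u, |φ n g u| ≤ ξ g) (hy : 0 ≤ y) (n : ℕ) (g : E) (u : S) :
    |{g | ξ g ≤ y}.indicator (fun g => φ n g u) g| ≤ y := by
  by_cases h : ξ g ≤ y
  · rw [Set.indicator_of_mem (by exact h)]; exact (hφξ n g u).trans h
  · rw [Set.indicator_of_notMem (by exact h)]; simpa using hy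

variable (hξ : Measurable ξ) (hφξ : ∀ n g u, |φ n g u| ≤ ξ g)

include hξ hφ in
omit [IsProbabilityMeasure μ] in
lemma measurable_truncated [SFinite μ] (n : ℕ) :
    Measurable (Function.uncurry (truncated μ ξ y φ n)) := by
  have hs : MeasurableSet {z : E × S | ξ z.1 ≤ y} :=
    measurableSet_le (hξ.comp measurable_fst) measurable_const
  have h1 : Measurable fun z : E × S => {g | ξ g ≤ y}.indicator (fun g => φ n g z.2) z.1 :=
    (hφ n).indicator hs
  have h2 : StronglyMeasurable
      (Function.uncurry fun (u : S) (g : E) => {g | ξ g ≤ y}.indicator (fun g => φ n g u) g) :=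
    (h1.comp measurable_swap).stronglyMeasurable
  exact h1.sub ((h2.integral_prod_right (ν := μ)).measurable.comp measurable_snd)

include hξ hφ hφξ in
lemma integrable_indicator (hy : 0 ≤ y) (n : ℕ) (u : S) :
    Integrable ({g | ξ g ≤ y}.indicator fun g => φ n g u) μ :=
  Integrable.of_bound (((hφ n).of_uncurry_right).indicator
      (measurableSet_le hξ measurable_const)).aestronglyMeasurable y
    (ae_of_all _ fun g => abs_indicator_le hφξ hy n g u)

include hφξ in
omit [MeasurableSpace S] in
lemma abs_truncated_le (hy : 0 ≤ y) (n : ℕ) (g : E) (u : S) :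
    |truncated μ ξ y φ n g u| ≤ 2 * y := by
  have h1 := abs_indicator_le hφξ hy n g u
  have h2 : |∫ g, {g | ξ g ≤ y}.indicator (fun g => φ n g u) g ∂μ| ≤ y := by
    have := norm_integral_le_of_norm_le_const (μ := μ)
      (f := fun g => {g | ξ g ≤ y}.indicator (fun g => φ n g u) g)
      (ae_of_all _ fun g => abs_indicator_le hφξ hy n g u)
    simpa using this
  exact (abs_sub _ _).trans (by linarith)

include hξ hφ hφξ in
lemma integral_truncated (hy : 0 ≤ y) (n : ℕ) (u : S) :
    ∫ g, truncated μ ξ y φ n g u ∂μ = 0 := by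
  have hi := integrable_indicator (μ := μ) hφ hξ hφξ hy n u
  simp only [truncated]
  rw [integral_sub hi (integrable_const _)]
  simp

include hξ hφ hφξ in
-- A variance is at most the second moment, and `φ` is dominated by `ξ`.
lemma integral_truncated_sq_le (hy : 0 ≤ y) (n : ℕ) (u : S) :
    ∫ g, truncated μ ξ y φ n g u ^ 2 ∂μ ≤ ∫ g, {g | ξ g ≤ y}.indicator (fun g => ξ g ^ 2) g ∂μ := by
  have hi := integrable_indicator (μ := μ) hφ hξ hφξ hy n u
  set f : E → ℝ := {g | ξ g ≤ y}.indicator fun g => φ n g u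
  set m := ∫ g, f g ∂μ
  have hs : MeasurableSet {g | ξ g ≤ y} := measurableSet_le hξ measurable_const
  have hfm : Measurable f := (hφ n).of_uncurry_right.indicator hs
  have hi2 : Integrable (fun g => f g ^ 2) μ :=
    Integrable.of_bound (hfm.pow_const 2).aestronglyMeasurable (y ^ 2) (ae_of_all _ fun g => by
      rw [Real.norm_eq_abs, abs_pow]
      exact pow_le_pow_left₀ (abs_nonneg _) (abs_indicator_le hφξ hy n g u) 2)
  have hle : ∀ g, f g ^ 2 ≤ {g | ξ g ≤ y}.indicator (fun g => ξ g ^ 2) g := fun g => by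
    by_cases h : ξ g ≤ y
    · simp only [f]
      rw [Set.indicator_of_mem (by exact h), Set.indicator_of_mem (by exact h), ← sq_abs]
      exact pow_le_pow_left₀ (abs_nonneg _) (hφξ n g u) 2
    · simp only [f]
      rw [Set.indicator_of_notMem (by exact h), Set.indicator_of_notMem (by exact h)]
      simp
  have hi3 : Integrable ({g | ξ g ≤ y}.indicator fun g => ξ g ^ 2) μ :=
    Integrable.of_bound ((hξ.pow_const 2).indicator hs).aestronglyMeasurable (y ^ 2)
      (ae_of_all _ fun g => by
        by_cases h : ξ g ≤ y
        · rw [Set.indicator_of_mem (by exact h), Real.norm_eq_abs, abs_pow]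
          refine pow_le_pow_left₀ (abs_nonneg _) ?_ 2
          rwa [abs_of_nonneg ((abs_nonneg _).trans (hφξ n g u))]
        · rw [Set.indicator_of_notMem (by exact h)]; simp; positivity)
  calc ∫ g, truncated μ ξ y φ n g u ^ 2 ∂μ = ∫ g, (f g ^ 2 - 2 * m * f g + m ^ 2) ∂μ := by
        refine integral_congr_ae (ae_of_all _ fun g => ?_)
        simp only [truncated, f, m]; ring
    _ = ∫ g, f g ^ 2 ∂μ - m ^ 2 := by
        rw [integral_add (by exact hi2.sub (hi.const_mul _)) (integrable_const _),
          integral_sub hi2 (hi.const_mul _), integral_const_mul]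
        simp only [integral_const, probReal_univ, one_smul]
        ring
    _ ≤ ∫ g, f g ^ 2 ∂μ := by linarith [sq_nonneg m]
    _ ≤ _ := integral_mono hi2 hi3 hle

include hξ hφ hφξ in
-- As `φ` has mean zero, its mean over `ξ ≤ y` is the opposite of its mean over `ξ > y`.
lemma abs_integral_indicator_le (hint : Integrable ξ μ) (hmean : ∀ n u, ∫ g, φ n g u ∂μ = 0)
    (hy : 0 ≤ y) (n : ℕ) (u : S) :
    |∫ g, {g | ξ g ≤ y}.indicator (fun g => φ n g u) g ∂μ| ≤
      ∫ g, {g | y < ξ g}.indicator ξ g ∂μ := by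
  have hi : Integrable (fun g => φ n g u) μ :=
    hint.mono' (hφ n).of_uncurry_right.aestronglyMeasurable (ae_of_all _ fun g => hφξ n g u)
  have hj := integrable_indicator (μ := μ) hφ hξ hφξ hy n u
  have hs : MeasurableSet {g | y < ξ g} := measurableSet_lt measurable_const hξ
  have h1 := integral_sub hj hi
  rw [hmean, sub_zero] at h1
  rw [← h1]
  refine abs_integral_le_integral_abs.trans (integral_mono (hj.sub hi).abs
    (hint.indicator hs) fun g => ?_)
  by_cases h : ξ g ≤ y
  · simp only [Set.indicator_of_mem (show g ∈ {g | ξ g ≤ y} from h),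
      Set.indicator_of_notMem (show g ∉ {g | y < ξ g} from not_lt.2 h)]
    simp
  · simp only [Set.indicator_of_notMem (show g ∉ {g | ξ g ≤ y} from h),
      Set.indicator_of_mem (show g ∈ {g | y < ξ g} from not_le.1 h)]
    simpa using hφξ n g u

include hφ hξ hφξ hY hlaw in
omit [IsProbabilityMeasure P] in
-- Unless some `ξ (Y i)` with `i < n` exceeds `y`, the two sums differ only by the recentring, at
-- most `n` tail means of `ξ`, and `hx` makes this half of the level.
lemma measure_maximal_le_truncated (hint : Integrable ξ μ)
    (hmean : ∀ n u, ∫ g, φ n g u ∂μ = 0) (hy : 0 ≤ y) {n : ℕ} {x : ℝ}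
    (hx : n * ∫ g, {g | y < ξ g}.indicator ξ g ∂μ ≤ x / 2) :
    P {ω | ∃ k ≤ n, x ≤ |chainSum T φ x₀ Y k ω|} ≤ n * μ {g | y < ξ g} +
      P {ω | ∃ k ≤ n, x / 2 ≤ |chainSum T (truncated μ ξ y φ) x₀ Y k ω|} := by
  set h := ∫ g, {g | y < ξ g}.indicator ξ g ∂μ
  have hs : MeasurableSet {g | y < ξ g} := measurableSet_lt measurable_const hξ
  have hsub : {ω | ∃ k ≤ n, x ≤ |chainSum T φ x₀ Y k ω|} ⊆
      (⋃ i ∈ Finset.range n, Y i ⁻¹' {g | y < ξ g}) ∪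
      {ω | ∃ k ≤ n, x / 2 ≤ |chainSum T (truncated μ ξ y φ) x₀ Y k ω|} := by
    rintro ω ⟨k, hk, hkx⟩
    by_cases hbad : ∃ i < n, y < ξ (Y i ω)
    · obtain ⟨i, hi, hyi⟩ := hbad
      exact Or.inl (Set.mem_biUnion (Finset.mem_coe.2 (Finset.mem_range.2 hi)) hyi)
    · push Not at hbad
      refine Or.inr ⟨k, hk, ?_⟩
      have hdiff : |chainSum T φ x₀ Y k ω - chainSum T (truncated μ ξ y φ) x₀ Y k ω| ≤ k * h := by
        rw [chainSum, chainSum, ← Finset.sum_sub_distrib]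
        refine (Finset.abs_sum_le_sum_abs _ _).trans ((Finset.sum_le_sum (g := fun _ => h)
          fun i hi => ?_).trans (by simp))
        have hin : i < n := (Finset.mem_range.1 hi).trans_le hk
        rw [truncated, Set.indicator_of_mem (show Y i ω ∈ {g | ξ g ≤ y} from hbad i hin),
          sub_sub_cancel]
        exact abs_integral_indicator_le hφ hξ hφξ hint hmean hy i _
      have hh0 : 0 ≤ h := (abs_nonneg _).trans
        (abs_integral_indicator_le hφ hξ hφξ hint hmean hy 0 x₀)
      have hkn : (k : ℝ) * h ≤ n * h :=
        mul_le_mul_of_nonneg_right (by exact_mod_cast hk) hh0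
      have := abs_sub_abs_le_abs_sub (chainSum T φ x₀ Y k ω)
        (chainSum T (truncated μ ξ y φ) x₀ Y k ω)
      linarith
  refine (measure_mono hsub).trans ((measure_union_le _ _).trans ?_)
  gcongr
  refine (measure_biUnion_finset_le _ _).trans ?_
  rw [Finset.sum_congr rfl fun i _ => by
    rw [← Measure.map_apply (hY i) hs, hlaw i]]
  simp

include hT hφ hξ hφξ hY hind hlaw

lemma measure_maximal_le_sq (hint : Integrable ξ μ)
    (hmean : ∀ n u, ∫ g, φ n g u ∂μ = 0) (hy : 0 ≤ y) {n : ℕ} {x : ℝ} (hx0 : 0 < x)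
    (hx : n * ∫ g, {g | y < ξ g}.indicator ξ g ∂μ ≤ x / 2) :
    P {ω | ∃ k ≤ n, x ≤ |chainSum T φ x₀ Y k ω|} ≤ n * μ {g | y < ξ g} +
      ENNReal.ofReal (n * (∫ g, {g | ξ g ≤ y}.indicator (fun g => ξ g ^ 2) g ∂μ) / (x / 2) ^ 2) :=
  (measure_maximal_le_truncated hφ hY hlaw hξ hφξ hint hmean hy hx).trans <| by
    gcongr
    exact measure_maximal_sq_le hT (measurable_truncated hφ hξ) hY hind hlaw
      (abs_truncated_le hφξ hy) (integral_truncated hφ hξ hφξ hy)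
      (integral_truncated_sq_le hφ hξ hφξ hy) (half_pos hx0) n

lemma measure_maximal_le_exp (hint : Integrable ξ μ)
    (hmean : ∀ n u, ∫ g, φ n g u ∂μ = 0) (hy : 0 ≤ y) {n : ℕ} {x t : ℝ} (ht : 0 ≤ t)
    (hx : n * ∫ g, {g | y < ξ g}.indicator ξ g ∂μ ≤ x / 2) :
    P {ω | ∃ k ≤ n, x ≤ |chainSum T φ x₀ Y k ω|} ≤ n * μ {g | y < ξ g} +
      ENNReal.ofReal (2 * Real.exp (n * ((∫ g, {g | ξ g ≤ y}.indicator (fun g => ξ g ^ 2) g ∂μ) *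
        t ^ 2 * Real.exp (t * (2 * y))) - t * (x / 2))) :=
  (measure_maximal_le_truncated hφ hY hlaw hξ hφξ hint hmean hy hx).trans <| by
    gcongr
    exact measure_maximal_exp_le hT (measurable_truncated hφ hξ) hY hind hlaw
      (abs_truncated_le hφξ hy) (integral_truncated hφ hξ hφξ hy)
      (integral_truncated_sq_le hφ hξ hφξ hy) ht n

end Truncation

end RandomChain

/-! ### The Baum-Katz series -/

namespace RandomChain

lemma tsum_pnat_le_sum {f : ℕ → ℝ≥0∞} {N : ℕ} (h : ∀ n, N < n → f n = 0) :
    ∑' n : ℕ+, f n ≤ ∑ n ∈ Finset.Icc 1 N, f n := by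
  have h1 : ∑' n : ℕ+, f n = ∑' n : ℕ, {n : ℕ | 0 < n}.indicator f n :=
    tsum_subtype {n : ℕ | 0 < n} f
  rw [h1, tsum_eq_sum (s := Finset.Icc 1 N)]
  · exact Finset.sum_le_sum fun n _ => Set.indicator_le_self _ _ _
  · intro n hn
    by_cases h0 : 0 < n
    · rw [Set.indicator_of_mem (by exact h0)]
      exact h n (by simp at hn; omega)
    · exact Set.indicator_of_notMem (by exact h0) _

/-- There are at most `R = w ^ α⁻¹` terms, each at most `R ^ (α * p - 1)` because `1 ≤ α * p`. -/
lemma tsum_pnat_rpow_indicator_le {α p w : ℝ} (hα : 0 < α) (hαp : 1 ≤ α * p) (hw : 0 ≤ w) :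
    ∑' n : ℕ+, {n : ℕ | (n : ℝ) ^ α ≤ w}.indicator
      (fun n : ℕ => ENNReal.ofReal ((n : ℝ) ^ (α * p - 1))) n ≤ ENNReal.ofReal (w ^ p) := by
  set R : ℝ := w ^ α⁻¹
  have hR : 0 ≤ R := Real.rpow_nonneg hw _
  have hiff : ∀ n : ℕ, (n : ℝ) ^ α ≤ w → (n : ℝ) ≤ R := fun n h =>
    (Real.le_rpow_inv_iff_of_pos (Nat.cast_nonneg n) hw hα).2 h
  refine (tsum_pnat_le_sum (N := ⌊R⌋₊) (f := {n : ℕ | (n : ℝ) ^ α ≤ w}.indicator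
      (fun n : ℕ => ENNReal.ofReal ((n : ℝ) ^ (α * p - 1)))) fun n hn =>
    Set.indicator_of_notMem (fun h => ?_) _).trans ?_
  · exact absurd (Nat.le_floor (hiff n h)) (not_le.2 hn)
  have hR2 : (⌊R⌋₊ : ℝ) * R ^ (α * p - 1) ≤ w ^ p := by
    rcases eq_or_lt_of_le hR with h0 | h0
    · rw [← h0]; simp; positivity
    · calc (⌊R⌋₊ : ℝ) * R ^ (α * p - 1) ≤ R * R ^ (α * p - 1) := by
            gcongr; exact Nat.floor_le hR
        _ = R ^ (α * p) := by
            rw [← Real.rpow_one_add' hR (by linarith)]; ring_nf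
        _ = w ^ p := by
            rw [← Real.rpow_mul hw, inv_mul_cancel_left₀ hα.ne']
  calc _ ≤ ∑ n ∈ Finset.Icc 1 ⌊R⌋₊, ENNReal.ofReal (R ^ (α * p - 1)) := by
        refine Finset.sum_le_sum fun n hn => (Set.indicator_le_self _ _ _).trans ?_
        have hnR : (n : ℝ) ≤ R := (Nat.le_floor_iff hR).1 (Finset.mem_Icc.1 hn).2
        exact ENNReal.ofReal_le_ofReal (Real.rpow_le_rpow (Nat.cast_nonneg n) hnR (by linarith))
    _ = ENNReal.ofReal (⌊R⌋₊ * R ^ (α * p - 1)) := by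
        rw [ENNReal.ofReal_mul (Nat.cast_nonneg _)]; simp
    _ ≤ _ := ENNReal.ofReal_le_ofReal hR2

/-- A telescoping substitute for comparison with an integral; it follows from `log u ≤ u - 1` at `u
= x / (x + 1)`. -/
lemma rpow_neg_sub_one_le {γ : ℝ} (hγ : 0 < γ) {x : ℝ} (hx : 0 < x) :
    (x + 1) ^ (-γ - 1) ≤ γ⁻¹ * (x ^ (-γ) - (x + 1) ^ (-γ)) := by
  have hx1 : 0 < x + 1 := by linarith
  have h1 : 1 + γ / (x + 1) ≤ (x / (x + 1)) ^ (-γ) := by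
    have h2 : Real.log (x / (x + 1)) ≤ x / (x + 1) - 1 :=
      Real.log_le_sub_one_of_pos (by positivity)
    have h3 : x / (x + 1) - 1 = -(1 / (x + 1)) := by field_simp; ring
    rw [Real.rpow_def_of_pos (by positivity)]
    refine le_trans ?_ (Real.add_one_le_exp _)
    rw [h3] at h2
    have h4 := mul_le_mul_of_nonneg_left h2 hγ.le
    have h5 : γ * -(1 / (x + 1)) = -(γ / (x + 1)) := by ring
    rw [h5] at h4
    linarith
  have h6 : (x / (x + 1)) ^ (-γ) * (x + 1) ^ (-γ) = x ^ (-γ) := by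
    rw [← Real.mul_rpow (by positivity) hx1.le, div_mul_cancel₀ _ hx1.ne']
  have h7 := mul_le_mul_of_nonneg_right h1 (Real.rpow_nonneg hx1.le (-γ))
  rw [h6] at h7
  rw [Real.rpow_sub_one hx1.ne', le_inv_mul_iff₀ hγ]
  have h8 : (1 + γ / (x + 1)) * (x + 1) ^ (-γ) =
    (x + 1) ^ (-γ) + γ * ((x + 1) ^ (-γ) / (x + 1)) := by ring
  linarith

lemma tsum_pnat_rpow_neg_indicator_le {γ R : ℝ} (hγ : 0 < γ) (hR : 1 ≤ R) :
    ∑' n : ℕ+, {n : ℕ | R ≤ n}.indicator (fun n : ℕ => ENNReal.ofReal ((n : ℝ) ^ (-γ - 1))) n ≤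
      ENNReal.ofReal ((1 + γ⁻¹) * R ^ (-γ)) := by
  set N := ⌈R⌉₊
  have hN : 1 ≤ N := Nat.one_le_ceil_iff.2 (by linarith)
  have hN' : (1 : ℝ) ≤ N := by exact_mod_cast hN
  set f : ℕ → ℝ≥0∞ :=
    {n : ℕ | R ≤ n}.indicator (fun n : ℕ => ENNReal.ofReal ((n : ℝ) ^ (-γ - 1)))
  have hanti : ∀ M : ℕ, ((N + M : ℕ) : ℝ) ^ (-γ) ≤ (N : ℝ) ^ (-γ) := fun M =>
    Real.rpow_le_rpow_of_nonpos (by linarith) (by push_cast; simp) (by linarith)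
  have hstep : ∀ M, ∑ n ∈ Finset.range (N + M + 1), f n ≤
      ENNReal.ofReal ((1 + γ⁻¹) * (N : ℝ) ^ (-γ) - γ⁻¹ * ((N + M : ℕ) : ℝ) ^ (-γ)) := by
    intro M
    induction M with
    | zero =>
      rw [add_zero, Finset.sum_range_succ, Finset.sum_eq_zero, zero_add]
      · refine (Set.indicator_le_self _ _ _).trans (ENNReal.ofReal_le_ofReal ?_)
        have := Real.rpow_le_rpow_of_exponent_le hN' (show -γ - 1 ≤ -γ by linarith)
        linarith
      · intro n hn
        refine Set.indicator_of_notMem (fun h => ?_) _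
        exact absurd (Nat.ceil_le.2 h) (not_le.2 (Finset.mem_range.1 hn))
    | succ M ih =>
      rw [← add_assoc, Finset.sum_range_succ]
      have h1 : f (N + M + 1) ≤ ENNReal.ofReal (((N + M + 1 : ℕ) : ℝ) ^ (-γ - 1)) :=
        Set.indicator_le_self _ _ _
      have h2 := rpow_neg_sub_one_le hγ (x := ((N + M : ℕ) : ℝ)) (by push_cast; linarith)
      have h3 := mul_le_mul_of_nonneg_left (hanti M) (inv_pos.2 hγ).le
      have h4 : 0 ≤ (N : ℝ) ^ (-γ) := by positivity
      refine (add_le_add ih h1).trans ?_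
      rw [← ENNReal.ofReal_add (by linarith) (by positivity)]
      refine ENNReal.ofReal_le_ofReal ?_
      rw [show ((N + M + 1 : ℕ) : ℝ) = ((N + M : ℕ) : ℝ) + 1 by push_cast; ring]
      linarith
  refine (ENNReal.tsum_comp_le_tsum_of_injective PNat.coe_injective f).trans
    (ENNReal.tsum_le_of_sum_range_le fun M => ?_)
  calc ∑ n ∈ Finset.range M, f n ≤ ∑ n ∈ Finset.range (N + M + 1), f n :=
        Finset.sum_le_sum_of_subset (Finset.range_mono (by omega))
    _ ≤ _ := hstep M
    _ ≤ _ := by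
        refine ENNReal.ofReal_le_ofReal ?_
        have h1 : (N : ℝ) ^ (-γ) ≤ R ^ (-γ) :=
          Real.rpow_le_rpow_of_nonpos (by linarith) (Nat.le_ceil R) (by linarith)
        have h2 : 0 ≤ γ⁻¹ * ((N + M : ℕ) : ℝ) ^ (-γ) := by positivity
        have h3 := mul_le_mul_of_nonneg_left h1 (show 0 ≤ 1 + γ⁻¹ by positivity)
        linarith

variable {E : Type*} [MeasurableSpace E] {μ : Measure E} {ξ : E → ℝ} {α p : ℝ}

/-- By Tonelli the series is the integral over `g` of the sum of `n ^ (α * p - 1)` over those `n`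
with `n ^ α ≤ ξ g / δ`. The dependence on `δ` is kept explicit because the coefficient estimate
later sums over levels `δ` tending to zero. -/
lemma tsum_mul_measure_le (hξ : Measurable ξ) (hξ0 : ∀ g, 0 ≤ ξ g) (hα : 0 < α)
    (hαp : 1 ≤ α * p) {δ : ℝ} (hδ : 0 < δ) :
    ∑' n : ℕ+, ENNReal.ofReal ((n : ℝ) ^ (α * p - 2)) *
        ((n : ℝ≥0∞) * μ {g | δ * (n : ℝ) ^ α ≤ ξ g}) ≤
      ENNReal.ofReal (δ ^ (-p)) * ∫⁻ g, ENNReal.ofReal (ξ g ^ p) ∂μ := by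
  have hm : ∀ n : ℕ, MeasurableSet {g | δ * (n : ℝ) ^ α ≤ ξ g} := fun n =>
    measurableSet_le measurable_const hξ
  have h1 : ∀ n : ℕ+, ENNReal.ofReal ((n : ℝ) ^ (α * p - 2)) *
        ((n : ℝ≥0∞) * μ {g | δ * (n : ℝ) ^ α ≤ ξ g}) =
      ∫⁻ g, {g | δ * ((n : ℕ) : ℝ) ^ α ≤ ξ g}.indicator
        (fun _ => ENNReal.ofReal (((n : ℕ) : ℝ) ^ (α * p - 1))) g ∂μ := by
    intro n
    have hn : (0 : ℝ) < n := by exact_mod_cast n.pos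
    rw [lintegral_indicator_const (hm n), ← mul_assoc]
    congr 1
    rw [show ((n : ℕ) : ℝ≥0∞) = ENNReal.ofReal (n : ℝ) by simp,
      ← ENNReal.ofReal_mul (by positivity), ← Real.rpow_add_one hn.ne']
    ring_nf
  rw [tsum_congr h1, ← lintegral_tsum fun n : ℕ+ =>
    (measurable_const.indicator (hm n)).aemeasurable]
  calc _ ≤ ∫⁻ g, ENNReal.ofReal (δ ^ (-p)) * ENNReal.ofReal (ξ g ^ p) ∂μ := by
        refine lintegral_mono fun g => ?_
        have h2 := tsum_pnat_rpow_indicator_le hα hαp (div_nonneg (hξ0 g) hδ.le)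
        rw [Real.div_rpow (hξ0 g) hδ.le, div_eq_inv_mul (ξ g ^ p), ← Real.rpow_neg hδ.le,
          ENNReal.ofReal_mul (by positivity)] at h2
        refine le_trans (ENNReal.tsum_le_tsum fun n => ?_) h2
        simp only [Set.indicator, Set.mem_ofPred_eq, le_div_iff₀ hδ, mul_comm δ]
        exact le_rfl
    _ = _ := lintegral_const_mul' _ _ ENNReal.ofReal_ne_top

/-- After Tonelli, `ξ ^ 2` multiplies the tail of a convergent series started at `n ≥ ξ ^ α⁻¹`,
which is of order `ξ ^ (p - 2)`. Convergence uses `p < 2`, and `1 ≤ ξ` keeps the starting index at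
least one. -/
lemma tsum_mul_truncated_sq_le (hξ : Measurable ξ) (hξ1 : ∀ g, 1 ≤ ξ g) (hα : 0 < α)
    (hp2 : p < 2) :
    ∑' n : ℕ+, ENNReal.ofReal ((n : ℝ) ^ (α * p - 2 * α - 1)) *
        ∫⁻ g, {g | ξ g ≤ (n : ℝ) ^ α}.indicator (fun g => ENNReal.ofReal (ξ g ^ 2)) g ∂μ ≤
      ENNReal.ofReal (1 + (2 * α - α * p)⁻¹) * ∫⁻ g, ENNReal.ofReal (ξ g ^ p) ∂μ := by
  set γ := 2 * α - α * p with hγdef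
  have hγ : 0 < γ := by nlinarith
  have hm : ∀ n : ℕ, Measurable fun g => {g | ξ g ≤ (n : ℝ) ^ α}.indicator
      (fun g => ENNReal.ofReal (ξ g ^ 2)) g := fun n =>
    (hξ.pow_const 2).ennreal_ofReal.indicator (measurableSet_le hξ measurable_const)
  have h1 : ∀ n : ℕ+, ENNReal.ofReal ((n : ℝ) ^ (α * p - 2 * α - 1)) *
        ∫⁻ g, {g | ξ g ≤ (n : ℝ) ^ α}.indicator (fun g => ENNReal.ofReal (ξ g ^ 2)) g ∂μ =
      ∫⁻ g, ENNReal.ofReal ((n : ℝ) ^ (α * p - 2 * α - 1)) *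
        {g | ξ g ≤ ((n : ℕ) : ℝ) ^ α}.indicator (fun g => ENNReal.ofReal (ξ g ^ 2)) g ∂μ := fun n =>
    (lintegral_const_mul _ (hm n)).symm
  rw [tsum_congr h1, ← lintegral_tsum fun n : ℕ+ => ((hm n).const_mul _).aemeasurable]
  calc _ ≤ ∫⁻ g, ENNReal.ofReal (1 + γ⁻¹) * ENNReal.ofReal (ξ g ^ p) ∂μ := by
        refine lintegral_mono fun g => ?_
        have hg0 : 0 < ξ g := zero_lt_one.trans_le (hξ1 g)
        have h2 := tsum_pnat_rpow_neg_indicator_le hγ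
          (Real.one_le_rpow (hξ1 g) (inv_pos.2 hα).le)
        have h3 : (ξ g ^ α⁻¹) ^ (-γ) = ξ g ^ (p - 2) := by
          rw [← Real.rpow_mul hg0.le]; congr 1; rw [hγdef]; field_simp; ring
        rw [h3] at h2
        have h4 : ENNReal.ofReal ((1 + γ⁻¹) * ξ g ^ (p - 2)) * ENNReal.ofReal (ξ g ^ 2) =
            ENNReal.ofReal (1 + γ⁻¹) * ENNReal.ofReal (ξ g ^ p) := by
          rw [← ENNReal.ofReal_mul (by positivity), ← ENNReal.ofReal_mul (by positivity),
            mul_assoc, ← Real.rpow_natCast, ← Real.rpow_add hg0]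
          norm_num
        rw [← h4]
        refine le_trans ?_ (mul_le_mul_left h2 _)
        rw [← ENNReal.tsum_mul_right]
        refine ENNReal.tsum_le_tsum fun n => ?_
        by_cases h : ξ g ≤ ((n : ℕ) : ℝ) ^ α
        · have h' : ξ g ^ α⁻¹ ≤ ((n : ℕ) : ℝ) :=
            (Real.rpow_inv_le_iff_of_pos hg0.le (Nat.cast_nonneg _) hα).2 h
          rw [Set.indicator_of_mem (by exact h), Set.indicator_of_mem (by exact h')]
          refine le_of_eq ?_
          congr 3; rw [hγdef]; ring
        · rw [Set.indicator_of_notMem (by exact h), mul_zero]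
          exact zero_le
    _ = _ := lintegral_const_mul' _ _ ENNReal.ofReal_ne_top

/-- On the tail `ξ ≤ (δ n^α)^(1-p) ξ^p`, and `n * n^(α(1-p)) ≤ n^α` because `1 ≤ α * p`. In the
boundary case `α * p = 1` no power of `n` is gained; the smallness comes from the tail of the
integral of `ξ ^ p`. -/
lemma eventually_mul_integral_tail_le [IsFiniteMeasure μ] (hξ : Measurable ξ) (hξ1 : ∀ g, 1 ≤ ξ g)
    (hp : 1 ≤ p) (hα : 0 < α) (hαp : 1 ≤ α * p)
    (hint : Integrable (fun g => ξ g ^ p) μ) {δ ε : ℝ} (hδ : 0 < δ) (hε : 0 < ε) :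
    ∀ᶠ n : ℕ in atTop, n * ∫ g, {g | δ * (n : ℝ) ^ α < ξ g}.indicator ξ g ∂μ ≤
      (n : ℝ) ^ α * ε / 2 := by
  have hms : ∀ n : ℕ, MeasurableSet {g | δ * (n : ℝ) ^ α < ξ g} := fun n =>
    measurableSet_lt measurable_const hξ
  have hle : ∀ g, ξ g ≤ ξ g ^ p := fun g => by
    simpa using Real.rpow_le_rpow_of_exponent_le (hξ1 g) hp
  have hint1 : Integrable ξ μ := hint.mono' hξ.aestronglyMeasurable (ae_of_all _ fun g => by
    rw [Real.norm_eq_abs, abs_of_nonneg (zero_le_one.trans (hξ1 g))]; exact hle g)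
  have hgrow : Tendsto (fun n : ℕ => δ * (n : ℝ) ^ α) atTop atTop :=
    ((tendsto_rpow_atTop hα).comp tendsto_natCast_atTop_atTop).const_mul_atTop hδ
  have hκ : Tendsto (fun n : ℕ => ∫ g, {g | δ * (n : ℝ) ^ α < ξ g}.indicator
      (fun g => ξ g ^ p) g ∂μ) atTop (𝓝 (∫ _, 0 ∂μ)) := by
    refine tendsto_integral_of_dominated_convergence (fun g => ξ g ^ p)
      (fun n => ((hξ.pow_const p).indicator (hms n)).aestronglyMeasurable) hint
      (fun n => ae_of_all _ fun g => ?_) (ae_of_all _ fun g => ?_)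
    · refine (norm_indicator_le_norm_self _ _).trans (le_of_eq ?_)
      rw [Real.norm_eq_abs, abs_of_nonneg]
      exact Real.rpow_nonneg (zero_le_one.trans (hξ1 g)) _
    · refine tendsto_const_nhds.congr' ?_
      filter_upwards [hgrow.eventually_ge_atTop (ξ g)] with n hn
      exact (Set.indicator_of_notMem (by exact not_lt.2 hn) _).symm
  rw [integral_zero] at hκ
  have hpos : 0 < ε / 2 / δ ^ (1 - p) := by positivity
  filter_upwards [hκ.eventually_le_const hpos, eventually_gt_atTop 0] with n hn hn0
  have hn1 : (1 : ℝ) ≤ n := by exact_mod_cast hn0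
  have hnpos : (0 : ℝ) < n := by linarith
  have h1 : ∫ g, {g | δ * (n : ℝ) ^ α < ξ g}.indicator ξ g ∂μ ≤
      (δ * (n : ℝ) ^ α) ^ (1 - p) *
        ∫ g, {g | δ * (n : ℝ) ^ α < ξ g}.indicator (fun g => ξ g ^ p) g ∂μ := by
    rw [← integral_const_mul]
    refine integral_mono (hint1.indicator (hms n)) ((hint.indicator (hms n)).const_mul _)
      fun g => ?_
    by_cases h : δ * (n : ℝ) ^ α < ξ g
    · simp only [Set.indicator_of_mem (show g ∈ {g | δ * (n : ℝ) ^ α < ξ g} from h)]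
      have hg0 : 0 < ξ g := zero_lt_one.trans_le (hξ1 g)
      calc ξ g = ξ g ^ (1 - p) * ξ g ^ p := by rw [← Real.rpow_add hg0]; simp
        _ ≤ _ := mul_le_mul_of_nonneg_right
          (Real.rpow_le_rpow_of_nonpos (by positivity) h.le (by linarith)) (by positivity)
    · simp only [Set.indicator_of_notMem (show g ∉ {g | δ * (n : ℝ) ^ α < ξ g} from h)]
      simp
  have h2 : (n : ℝ) * (δ * (n : ℝ) ^ α) ^ (1 - p) ≤ (n : ℝ) ^ α * δ ^ (1 - p) := by
    rw [Real.mul_rpow hδ.le (by positivity), ← Real.rpow_mul hnpos.le]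
    calc (n : ℝ) * (δ ^ (1 - p) * (n : ℝ) ^ (α * (1 - p)))
        = (n : ℝ) ^ (α * (1 - p) + 1) * δ ^ (1 - p) := by
          rw [Real.rpow_add_one hnpos.ne']; ring
      _ ≤ _ := by
          gcongr
          nlinarith
  calc (n : ℝ) * ∫ g, {g | δ * (n : ℝ) ^ α < ξ g}.indicator ξ g ∂μ
      ≤ n * ((δ * (n : ℝ) ^ α) ^ (1 - p) * (ε / 2 / δ ^ (1 - p))) := by
        gcongr
        refine h1.trans ?_
        gcongr
    _ = n * (δ * (n : ℝ) ^ α) ^ (1 - p) * (ε / 2 / δ ^ (1 - p)) := by ring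
    _ ≤ (n : ℝ) ^ α * δ ^ (1 - p) * (ε / 2 / δ ^ (1 - p)) := by gcongr
    _ = _ := by field_simp

/-- Estimates valid only for large `n` suffice: the first terms may be replaced by the trivial bound
on a probability. -/
lemma tsum_mul_ite_lt_top {c f : ℕ → ℝ≥0∞} (hc : ∀ n, c n ≠ ∞)
    (h : ∑' n : ℕ+, c n * f n < ∞) (N : ℕ) :
    ∑' n : ℕ+, c n * (if (n : ℕ) < N then 1 else f n) < ∞ := by
  have h1 : ∑' n : ℕ+, (if (n : ℕ) < N then c n else 0) < ∞ := by
    refine (tsum_pnat_le_sum (N := N) (f := fun n => if n < N then c n else 0)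
      fun n hn => if_neg (by omega)).trans_lt ?_
    refine ENNReal.sum_lt_top.2 fun n _ => ?_
    split_ifs
    · exact (hc n).lt_top
    · exact ENNReal.zero_lt_top
  refine lt_of_le_of_lt ?_ (ENNReal.add_lt_top.2 ⟨h1, h⟩)
  rw [← ENNReal.tsum_add]
  refine ENNReal.tsum_le_tsum fun n => ?_
  split_ifs
  · rw [mul_one]; exact le_self_add
  · rw [zero_add]

lemma tsum_pnat_rpow_neg_two_lt_top : ∑' n : ℕ+, ENNReal.ofReal ((n : ℝ) ^ (-2 : ℝ)) < ∞ := by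
  have h := tsum_pnat_rpow_neg_indicator_le (γ := 1) (R := 1) one_pos le_rfl
  refine lt_of_le_of_lt (le_of_eq (tsum_congr fun n => ?_)) (h.trans_lt ENNReal.ofReal_lt_top)
  rw [Set.indicator_of_mem (by
    change (1 : ℝ) ≤ ((n : ℕ) : ℝ)
    exact_mod_cast n.pos)]
  norm_num

/-- A convergent Baum-Katz type bound for the maximal sums along a chain, uniform in the increments
dominated by `ξ` and in the starting point. -/
theorem exists_maximal_bound {S Ω : Type*} [MeasurableSpace S] [MeasurableSpace Ω]
    [IsProbabilityMeasure μ] {P : Measure Ω} [IsProbabilityMeasure P] {T : E → S → S}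
    (hT : Measurable (Function.uncurry T)) {Y : ℕ → Ω → E} (hY : ∀ n, Measurable (Y n))
    (hind : iIndepFun Y P) (hlaw : ∀ n, P.map (Y n) = μ)
    (hξ : Measurable ξ) (hξ1 : ∀ g, 1 ≤ ξ g)
    (hp : 1 ≤ p) (hα : 1 / 2 < α) (hαp : 1 ≤ α * p)
    (hint : Integrable (fun g => ξ g ^ p) μ) {ε : ℝ} (hε : 0 < ε) :
    ∃ b : ℕ → ℝ≥0∞, ∑' n : ℕ+, ENNReal.ofReal ((n : ℝ) ^ (α * p - 2)) * b n < ∞ ∧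
      ∀ (φ : ℕ → E → S → ℝ) (x₀ : S), (∀ n, Measurable (Function.uncurry (φ n))) →
        (∀ n g u, |φ n g u| ≤ ξ g) → (∀ n u, ∫ g, φ n g u ∂μ = 0) →
        ∀ n : ℕ, 0 < n → P {ω | ∃ k ≤ n, (n : ℝ) ^ α * ε ≤ |chainSum T φ x₀ Y k ω|} ≤ b n := by
  have hα0 : 0 < α := by linarith
  have hξ0 : ∀ g, 0 ≤ ξ g := fun g => zero_le_one.trans (hξ1 g)
  have hint1 : Integrable ξ μ := hint.mono' hξ.aestronglyMeasurable (ae_of_all _ fun g => by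
    rw [Real.norm_eq_abs, abs_of_nonneg (hξ0 g)]
    simpa using Real.rpow_le_rpow_of_exponent_le (hξ1 g) hp)
  have hfin : ∫⁻ g, ENNReal.ofReal (ξ g ^ p) ∂μ < ∞ :=
    (hasFiniteIntegral_iff_ofReal (ae_of_all _ fun g => Real.rpow_nonneg (hξ0 g) p)).1 hint.2
  have htail : ∀ {δ : ℝ}, 0 < δ → ∑' n : ℕ+, ENNReal.ofReal ((n : ℝ) ^ (α * p - 2)) *
      ((n : ℝ≥0∞) * μ {g | δ * (n : ℝ) ^ α < ξ g}) < ∞ := fun {δ} hδ => by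
    refine lt_of_le_of_lt (ENNReal.tsum_le_tsum fun n => ?_)
      ((tsum_mul_measure_le hξ hξ0 hα0 hαp hδ).trans_lt
        (ENNReal.mul_lt_top ENNReal.ofReal_lt_top hfin))
    gcongr
    exact fun h => le_of_lt h
  suffices hmain : ∃ (δ : ℝ) (f : ℕ → ℝ≥0∞), 0 < δ ∧
      ∑' n : ℕ+, ENNReal.ofReal ((n : ℝ) ^ (α * p - 2)) * f n < ∞ ∧
      ∀ (φ : ℕ → E → S → ℝ) (x₀ : S), (∀ n, Measurable (Function.uncurry (φ n))) →
        (∀ n g u, |φ n g u| ≤ ξ g) → (∀ n u, ∫ g, φ n g u ∂μ = 0) →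
        ∀ n : ℕ, 0 < n → n * ∫ g, {g | δ * (n : ℝ) ^ α < ξ g}.indicator ξ g ∂μ ≤
          (n : ℝ) ^ α * ε / 2 →
        P {ω | ∃ k ≤ n, (n : ℝ) ^ α * ε ≤ |chainSum T φ x₀ Y k ω|} ≤
          n * μ {g | δ * (n : ℝ) ^ α < ξ g} + f n by
    obtain ⟨δ, f, hδ, hf, hbd⟩ := hmain
    obtain ⟨N, hN⟩ := eventually_atTop.1
      (eventually_mul_integral_tail_le hξ hξ1 hp hα0 hαp hint hδ hε)
    refine ⟨fun n => if n < N then 1 else n * μ {g | δ * (n : ℝ) ^ α < ξ g} + f n,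
      tsum_mul_ite_lt_top (c := fun n => ENNReal.ofReal ((n : ℝ) ^ (α * p - 2)))
        (f := fun n => n * μ {g | δ * (n : ℝ) ^ α < ξ g} + f n)
        (fun _ => ENNReal.ofReal_ne_top) ?_ N, ?_⟩
    · simp only [mul_add, ENNReal.tsum_add]
      exact ENNReal.add_lt_top.2 ⟨htail hδ, hf⟩
    · intro φ x₀ hφ hφξ hmean n hn
      dsimp only
      split_ifs with h
      · exact prob_le_one
      · exact hbd φ x₀ hφ hφξ hmean n hn (hN n (not_lt.1 h))
  -- The second-moment bound produces `n ^ (α * p - 2 * α - 1)` times a truncated second moment of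
  -- `ξ`, which is summable for `p < 2`. For `p ≥ 2` that exponent is at least `-1`, so an
  -- exponential bound replaces it.
  rcases lt_or_ge p 2 with hp2 | hp2
  · refine ⟨1, fun n => ENNReal.ofReal (n *
      (∫ g, {g | ξ g ≤ 1 * (n : ℝ) ^ α}.indicator (fun g => ξ g ^ 2) g ∂μ) /
        ((n : ℝ) ^ α * ε / 2) ^ 2), one_pos, ?_, fun φ x₀ hφ hφξ hmean n hn hx =>
      measure_maximal_le_sq hT hφ hY hind hlaw hξ hφξ hint1 hmean (by positivity)
        (by have : (0 : ℝ) < n := by exact_mod_cast hn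
            positivity) hx⟩
    have hterm : ∀ n : ℕ+, ENNReal.ofReal ((n : ℝ) ^ (α * p - 2)) * ENNReal.ofReal (n *
        (∫ g, {g | ξ g ≤ 1 * (n : ℝ) ^ α}.indicator (fun g => ξ g ^ 2) g ∂μ) /
          ((n : ℝ) ^ α * ε / 2) ^ 2) = ENNReal.ofReal (4 / ε ^ 2) *
        (ENNReal.ofReal ((n : ℝ) ^ (α * p - 2 * α - 1)) *
        ∫⁻ g, {g | ξ g ≤ (n : ℝ) ^ α}.indicator (fun g => ENNReal.ofReal (ξ g ^ 2)) g ∂μ) := by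
      intro n
      have hn : (0 : ℝ) < n := by exact_mod_cast n.pos
      simp only [one_mul]
      have hs : MeasurableSet {g | ξ g ≤ (n : ℝ) ^ α} := measurableSet_le hξ measurable_const
      have h0 : ∀ g, 0 ≤ {g | ξ g ≤ (n : ℝ) ^ α}.indicator (fun g => ξ g ^ 2) g := fun g =>
        Set.indicator_nonneg (fun _ _ => sq_nonneg _) g
      have hV : ∫⁻ g, {g | ξ g ≤ (n : ℝ) ^ α}.indicator
          (fun g => ENNReal.ofReal (ξ g ^ 2)) g ∂μ = ENNReal.ofReal
          (∫ g, {g | ξ g ≤ (n : ℝ) ^ α}.indicator (fun g => ξ g ^ 2) g ∂μ) := by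
        rw [ofReal_integral_eq_lintegral_ofReal _ (ae_of_all _ h0)]
        · refine lintegral_congr fun g => ?_
          by_cases h : ξ g ≤ (n : ℝ) ^ α
          · simp [Set.indicator, h]
          · simp [Set.indicator, h]
        · refine Integrable.of_bound ((hξ.pow_const 2).indicator hs).aestronglyMeasurable
            (((n : ℝ) ^ α) ^ 2) (ae_of_all _ fun g => ?_)
          rw [Real.norm_eq_abs, abs_of_nonneg (h0 g)]
          refine Set.indicator_le' (fun g hg => pow_le_pow_left₀ (hξ0 g) hg 2)
            (fun g _ => by positivity) g
      rw [hV, ← ENNReal.ofReal_mul (by positivity), ← ENNReal.ofReal_mul (by positivity),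
        ← ENNReal.ofReal_mul (by positivity)]
      congr 1
      have h1 : (n : ℝ) ^ (α * p - 2 * α - 1) * ((n : ℝ) ^ α) ^ 2 = (n : ℝ) ^ (α * p - 2) * n := by
        rw [← Real.rpow_mul_natCast hn.le, ← Real.rpow_add hn, ← Real.rpow_add_one hn.ne']
        congr 1; push_cast; ring
      have h2 : (n : ℝ) ^ α ≠ 0 := by positivity
      generalize ∫ g, {g | ξ g ≤ (n : ℝ) ^ α}.indicator (fun g => ξ g ^ 2) g ∂μ = V
      generalize (n : ℝ) ^ (α * p - 2 * α - 1) = a at h1 ⊢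
      generalize (n : ℝ) ^ (α * p - 2) = b at h1 ⊢
      generalize (n : ℝ) ^ α = c at h1 h2 ⊢
      field_simp
      linear_combination (-4) * V * h1
    rw [tsum_congr hterm, ENNReal.tsum_mul_left]
    exact ENNReal.mul_lt_top ENNReal.ofReal_lt_top
      ((tsum_mul_truncated_sq_le hξ hξ1 hα0 hp2).trans_lt
        (ENNReal.mul_lt_top ENNReal.ofReal_lt_top hfin))
  -- With truncation level `δ n^α` and `t = κ log n / (2 δ n^α)`, the error factor `exp (t * 2y)` is
  -- `n^κ`, while the choice of `δ` makes `t * (x / 2)` equal to `α * p * log n`. The quadratic term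
  -- stays bounded since `1 + 2 * κ = 2 * α`: one `n^κ` is this error factor, the other absorbs
  -- `(log n)²`. The outcome `n^(-α p)` leaves the summable weight `n^(-2)`.
  · set κ : ℝ := (2 * α - 1) / 2 with hκdef
    have hκ : 0 < κ := by rw [hκdef]; linarith
    have hαp0 : 0 < α * p := by linarith
    set δ : ℝ := κ * ε / (4 * (α * p)) with hδdef
    have hδ : 0 < δ := by positivity
    have hint2 : Integrable (fun g => ξ g ^ 2) μ :=
      hint.mono' (hξ.pow_const 2).aestronglyMeasurable (ae_of_all _ fun g => by
        rw [Real.norm_eq_abs, abs_of_nonneg (sq_nonneg _), ← Real.rpow_natCast]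
        exact Real.rpow_le_rpow_of_exponent_le (hξ1 g) (by exact_mod_cast hp2))
    set v : ℝ := ∫ g, ξ g ^ 2 ∂μ
    have hv : 0 ≤ v := integral_nonneg fun _ => sq_nonneg _
    refine ⟨δ, fun n => ENNReal.ofReal (2 * Real.exp (v / δ ^ 2) * (n : ℝ) ^ (-(α * p))), hδ, ?_,
      fun φ x₀ hφ hφξ hmean n hn hx => ?_⟩
    · have hterm : ∀ n : ℕ+, ENNReal.ofReal ((n : ℝ) ^ (α * p - 2)) *
          ENNReal.ofReal (2 * Real.exp (v / δ ^ 2) * (n : ℝ) ^ (-(α * p))) =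
          ENNReal.ofReal (2 * Real.exp (v / δ ^ 2)) * ENNReal.ofReal ((n : ℝ) ^ (-2 : ℝ)) := by
        intro n
        have hn : (0 : ℝ) < n := by exact_mod_cast n.pos
        rw [← ENNReal.ofReal_mul (by positivity), ← ENNReal.ofReal_mul (by positivity)]
        congr 1
        rw [show (-2 : ℝ) = (α * p - 2) + -(α * p) by ring, Real.rpow_add hn]
        ring
      rw [tsum_congr hterm, ENNReal.tsum_mul_left]
      exact ENNReal.mul_lt_top ENNReal.ofReal_lt_top tsum_pnat_rpow_neg_two_lt_top
    · have hn0 : (0 : ℝ) < n := by exact_mod_cast hn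
      have hn1 : (1 : ℝ) ≤ n := by exact_mod_cast hn
      have hlog : 0 ≤ Real.log n := Real.log_nonneg hn1
      set r : ℝ := (n : ℝ) ^ α with hr
      have hr0 : 0 < r := by positivity
      set t : ℝ := κ * Real.log n / (2 * δ * r) with ht
      have ht0 : 0 ≤ t := by positivity
      refine (measure_maximal_le_exp hT hφ hY hind hlaw hξ hφξ hint1 hmean
        (y := δ * r) (by positivity) ht0 hx).trans ?_
      dsimp only
      refine add_le_add_right (ENNReal.ofReal_le_ofReal ?_) _
      have hVv : ∫ g, {g | ξ g ≤ δ * r}.indicator (fun g => ξ g ^ 2) g ∂μ ≤ v :=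
        integral_mono (hint2.indicator (measurableSet_le hξ measurable_const)) hint2 fun g =>
          Set.indicator_le_self' (fun _ _ => sq_nonneg _) g
      have he1 : t * (2 * (δ * r)) = Real.log n * κ := by rw [ht]; field_simp
      have he2 : t * (r * ε / 2) = Real.log n * (α * p) := by
        rw [ht, hδdef]; field_simp; ring
      have he3 : Real.exp (t * (2 * (δ * r))) = (n : ℝ) ^ κ := by
        rw [he1, Real.rpow_def_of_pos hn0]
      have he4 : n * (v * t ^ 2 * (n : ℝ) ^ κ) ≤ v / δ ^ 2 := by
        have hl : Real.log n ≤ (n : ℝ) ^ (κ / 2) / (κ / 2) :=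
          Real.log_le_rpow_div hn0.le (half_pos hκ)
        have hl2 : (κ * Real.log n) ^ 2 ≤ 4 * (n : ℝ) ^ κ := by
          have : κ * Real.log n ≤ 2 * (n : ℝ) ^ (κ / 2) := by
            rw [le_div_iff₀ (half_pos hκ)] at hl; linarith
          calc (κ * Real.log n) ^ 2 ≤ (2 * (n : ℝ) ^ (κ / 2)) ^ 2 :=
                pow_le_pow_left₀ (by positivity) this 2
            _ = 4 * (n : ℝ) ^ κ := by
                rw [mul_pow, ← Real.rpow_mul_natCast hn0.le]
                norm_num
        have hexpn : (n : ℝ) * (n : ℝ) ^ κ * (n : ℝ) ^ κ = r ^ 2 := by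
          rw [hr, ← Real.rpow_mul_natCast hn0.le, mul_assoc, ← Real.rpow_add hn0,
            ← Real.rpow_one_add' hn0.le (by positivity)]
          congr 1; rw [hκdef]; push_cast; ring
        calc n * (v * t ^ 2 * (n : ℝ) ^ κ)
            = n * (n : ℝ) ^ κ * v / (4 * δ ^ 2 * r ^ 2) * (κ * Real.log n) ^ 2 := by
              rw [ht]; field_simp; ring
          _ ≤ n * (n : ℝ) ^ κ * v / (4 * δ ^ 2 * r ^ 2) * (4 * (n : ℝ) ^ κ) := by gcongr
          _ = v / δ ^ 2 * ((n : ℝ) * (n : ℝ) ^ κ * (n : ℝ) ^ κ / r ^ 2) := by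
              field_simp
          _ = v / δ ^ 2 := by rw [hexpn, div_self (by positivity), mul_one]
      rw [he2, he3, mul_assoc 2]
      refine mul_le_mul_of_nonneg_left ?_ (by norm_num)
      rw [Real.rpow_def_of_pos hn0 (-(α * p)), ← Real.exp_add]
      refine Real.exp_le_exp.2 ?_
      have : n * ((∫ g, {g | ξ g ≤ δ * r}.indicator (fun g => ξ g ^ 2) g ∂μ) *
          t ^ 2 * (n : ℝ) ^ κ) ≤ n * (v * t ^ 2 * (n : ℝ) ^ κ) := by gcongr
      linarith

end RandomChain

/-! ### Deviations of the cocycle and the law of large numbers -/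

namespace PosMat

variable {d : ℕ} [NeZero d] {μ : Measure (G d)} [IsProbabilityMeasure μ]
  {Ω : Type*} {Y : ℕ → Ω → G d}

omit [IsProbabilityMeasure μ] in
lemma chain_act (x : simplex d) (n : ℕ) (ω : Ω) :
    RandomChain.chain (fun _ => act) x Y n ω = act (leftProd Y n ω) x := by
  induction n with
  | zero => simp [RandomChain.chain, leftProd, act_one]
  | succ n ih => simp only [RandomChain.chain, leftProd, act_mul, ih]

omit [IsProbabilityMeasure μ] in
-- The sum telescopes. The increments are indexed by the number of remaining factors, so step `i`
-- uses `n - 1 - i`, and the right side is the centred conditional mean of `σ(A_n, x)` after `k`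
-- factors.
lemma chainSum_increment (x : simplex d) (ω : Ω) {n k : ℕ} (hk : k ≤ n) :
    RandomChain.chainSum act (fun i => increment μ (n - 1 - i)) x Y k ω =
      cocycle (leftProd Y k ω) x + meanCocycle μ (n - k) (act (leftProd Y k ω) x) -
        meanCocycle μ n x := by
  induction k with
  | zero => simp [RandomChain.chainSum, leftProd, cocycle_one, act_one]
  | succ k ih =>
    rw [RandomChain.chainSum, Finset.sum_range_succ, ← RandomChain.chainSum, ih (by omega),
      chain_act, increment, show n - 1 - k + 1 = n - k by omega,
      show n - 1 - k = n - (k + 1) by omega]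
    simp only [leftProd, cocycle_mul, act_mul]
    ring

variable [MeasurableSpace Ω] {P : Measure Ω} [IsProbabilityMeasure P]
  (hY : ∀ n, Measurable (Y n)) (hind : iIndepFun Y P) (hlaw : ∀ n, P.map (Y n) = μ)
  (hμ : StrictlyContracting μ)

include hY hind hlaw hμ

/-- Large deviations of the norm cocycle, uniformly in the starting point. -/
theorem exists_cocycle_maximal_bound {p α : ℝ} (hp : 1 ≤ p) (hmom : HasMoment μ p)
    (hα : 1 / 2 < α) (hαp : 1 ≤ α * p) {ε : ℝ} (hε : 0 < ε) :
    ∃ b : ℕ → ℝ≥0∞, ∑' n : ℕ+, ENNReal.ofReal ((n : ℝ) ^ (α * p - 2)) * b n < ∞ ∧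
      ∀ (x : simplex d) (n : ℕ), 0 < n →
        P {ω | ∃ k ≤ n, (n : ℝ) ^ α * ε ≤
          |cocycle (leftProd Y k ω) x - k * lyapunov μ|} ≤ b n := by
  have h1 := hmom.integrable_logN hp
  obtain ⟨C, hC0, hC⟩ := exists_integral_osc_le hμ h1
  set B : ℝ := |lyapunov μ| + 4 * C + 1
  have hB : 1 ≤ B := by
    have := abs_nonneg (lyapunov μ)
    simp only [B]; linarith
  set ξ : G d → ℝ := fun g => logN g + B
  have hξ : Measurable ξ := measurable_logN.add_const B
  have hξ1 : ∀ g, 1 ≤ ξ g := fun g => by have := logN_nonneg g; simp only [ξ]; linarith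
  have hintN : Integrable (fun g => logN g ^ p) μ :=
    ⟨(measurable_logN.pow_const p).aestronglyMeasurable,
      (hasFiniteIntegral_iff_ofReal (ae_of_all _ fun g => Real.rpow_nonneg (logN_nonneg g) p)).2
        hmom⟩
  have hint : Integrable (fun g => ξ g ^ p) μ :=
    ((hintN.add (integrable_const (B ^ p))).const_mul (2 ^ p)).mono'
      (hξ.pow_const p).aestronglyMeasurable (ae_of_all _ fun g => by
        rw [Real.norm_eq_abs, abs_of_nonneg (Real.rpow_nonneg (zero_le_one.trans (hξ1 g)) p)]
        exact add_rpow_le (logN_nonneg g) (by linarith) (by linarith))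
  obtain ⟨b, hb, hbd⟩ := RandomChain.exists_maximal_bound (T := act) measurable_act hY hind hlaw hξ
    hξ1 hp hα hαp hint (half_pos hε)
  have hgrow : Tendsto (fun n : ℕ => (n : ℝ) ^ α * (ε / 2)) atTop atTop :=
    ((tendsto_rpow_atTop (by linarith)).comp tendsto_natCast_atTop_atTop).atTop_mul_const
      (half_pos hε)
  -- The martingale and `σ(A_k, x) - k λ` differ by at most `2 * C + 2 * C`, absorbed by half of the
  -- level once `n` is large.
  obtain ⟨N, hN⟩ := eventually_atTop.1 (hgrow.eventually_ge_atTop (4 * C))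
  refine ⟨fun n => if n < N then 1 else b n, RandomChain.tsum_mul_ite_lt_top
    (c := fun n => ENNReal.ofReal ((n : ℝ) ^ (α * p - 2))) (fun _ => ENNReal.ofReal_ne_top) hb N,
    fun x n hn => ?_⟩
  dsimp only
  split_ifs with hnN
  · exact prob_le_one
  refine le_trans (measure_mono ?_) (hbd (fun i => increment μ (n - 1 - i)) x
    (fun i => measurable_increment _)
    (fun i g u => (abs_increment_le h1 hC0 hC _ g u).trans (by simp only [ξ, B]; linarith))
    (fun i u => integral_increment h1 hC0 hC _ u) n hn)
  rintro ω ⟨k, hk, hkx⟩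
  refine ⟨k, hk, ?_⟩
  rw [chainSum_increment x ω hk]
  have h2 := abs_le.1 (abs_meanCocycle_sub_le h1 hC0 hC (n - k) (act (leftProd Y k ω) x))
  have h3 := abs_le.1 (abs_meanCocycle_sub_le h1 hC0 hC n x)
  have h4 := hN n (not_lt.1 hnN)
  rw [Nat.cast_sub hk] at h2
  rcases le_abs.1 hkx with h5 | h5
  · exact le_abs.2 (Or.inl (by linarith [h2.1, h3.2]))
  · exact le_abs.2 (Or.inr (by linarith [h2.2, h3.1]))

omit [NeZero d] [IsProbabilityMeasure P] [IsProbabilityMeasure μ] hind hlaw hμ in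
lemma measurableSet_maximal (x : simplex d) (c l : ℝ) (n : ℕ) :
    MeasurableSet {ω | ∃ k ≤ n, c ≤ |cocycle (leftProd Y k ω) x - k * l|} := by
  have : {ω | ∃ k ≤ n, c ≤ |cocycle (leftProd Y k ω) x - k * l|} =
      ⋃ k ∈ Set.Iic n, {ω | c ≤ |cocycle (leftProd Y k ω) x - k * l|} := by
    ext; simp
  rw [this]
  refine MeasurableSet.biUnion (Set.to_countable _) fun k _ => measurableSet_le measurable_const ?_
  exact ((((measurable_cocycle_left x).comp (measurable_leftProd hY k)).sub_const _)).abs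

/-- For `p = α = 1` the weights are `1 / n`, too small for Borel-Cantelli. Instead, almost surely
the sum of `1 / n` over the `n` with `ω ∈ A n` converges, and one large deviation at time `k` puts
`ω` in every `A n` with `k ≤ n < 2 * k`, a stretch contributing at least `1 / 2`. -/
lemma ae_eventually_abs_cocycle_sub_lt (h1 : HasMoment μ 1) (x : simplex d) {ε : ℝ} (hε : 0 < ε) :
    ∀ᵐ ω ∂P, ∀ᶠ k : ℕ in atTop,
      |cocycle (leftProd Y k ω) x - k * lyapunov μ| < 2 * k * ε := by
  obtain ⟨b, hb, hbd⟩ := exists_cocycle_maximal_bound hY hind hlaw hμ le_rfl h1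
    (α := 1) (by norm_num) (by norm_num) hε
  set A : ℕ → Set Ω := fun n => {ω | ∃ k ≤ n, (n : ℝ) ^ (1 : ℝ) * ε ≤
    |cocycle (leftProd Y k ω) x - k * lyapunov μ|}
  have hA : ∀ n, MeasurableSet (A n) := fun n => measurableSet_maximal hY x _ _ n
  set f : ℕ → Ω → ℝ≥0∞ := fun n => (A n).indicator fun _ => ENNReal.ofReal ((n : ℝ)⁻¹)
  have hfin : ∫⁻ ω, ∑' n : ℕ+, f n ω ∂P < ∞ := by
    rw [lintegral_tsum fun n : ℕ+ => (measurable_const.indicator (hA n)).aemeasurable]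
    refine lt_of_le_of_lt (ENNReal.tsum_le_tsum fun n => ?_) hb
    rw [lintegral_indicator_const (hA n), show (1 * 1 - 2 : ℝ) = -1 by norm_num,
      Real.rpow_neg_one]
    gcongr
    exact hbd x n n.pos
  have hmeas : AEMeasurable (fun ω => ∑' n : ℕ+, f n ω) P :=
    (Measurable.tsum fun n : ℕ+ => measurable_const.indicator (hA n)).aemeasurable
  filter_upwards [ae_lt_top' hmeas hfin.ne] with ω hω
  have hsum : Summable fun n : ℕ => (f n ω).toReal := by
    refine ENNReal.summable_toReal (ne_of_lt (lt_of_le_of_lt (le_of_eq ?_) hω))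
    have h2 : ∑' n : ℕ+, f n ω = ∑' n : ℕ, {n : ℕ | 0 < n}.indicator (fun n => f n ω) n :=
      tsum_subtype {n : ℕ | 0 < n} fun n => f n ω
    rw [h2]
    refine tsum_congr fun n => ?_
    rcases Nat.eq_zero_or_pos n with rfl | hn
    · simp [f, Set.indicator]
    · exact (Set.indicator_of_mem (s := {n : ℕ | 0 < n}) hn fun n => f n ω).symm
  have ht := hsum.hasSum.tendsto_sum_nat
  have ht2 : Tendsto (fun k : ℕ => ∑ n ∈ Finset.range (2 * k), (f n ω).toReal -
      ∑ n ∈ Finset.range k, (f n ω).toReal) atTop (𝓝 0) := by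
    have := (ht.comp (tendsto_id.const_mul_atTop' (r := 2) two_pos)).sub ht
    simpa using this
  filter_upwards [ht2.eventually_lt_const (show (0 : ℝ) < 1 / 2 by norm_num),
    eventually_gt_atTop 0] with k hk hk0
  by_contra! hcon
  have hk0' : (0 : ℝ) < k := by exact_mod_cast hk0
  rw [← Finset.sum_Ico_eq_sub _ (by omega : k ≤ 2 * k)] at hk
  have hlow : ∀ n ∈ Finset.Ico k (2 * k), 1 / (2 * k : ℝ) ≤ (f n ω).toReal := by
    intro n hn
    obtain ⟨hn1, hn2⟩ := Finset.mem_Ico.1 hn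
    have hn0 : (0 : ℝ) < n := by exact_mod_cast hk0.trans_le hn1
    have hn2' : (n : ℝ) ≤ 2 * k := by exact_mod_cast hn2.le
    have hmem : ω ∈ A n := ⟨k, hn1, by
      rw [Real.rpow_one]
      exact (mul_le_mul_of_nonneg_right hn2' hε.le).trans hcon⟩
    simp only [f]
    rw [Set.indicator_of_mem hmem, ENNReal.toReal_ofReal (by positivity), one_div]
    exact inv_anti₀ hn0 hn2'
  have := Finset.card_nsmul_le_sum _ _ _ hlow
  rw [Nat.card_Ico, show 2 * k - k = k by omega, nsmul_eq_mul] at this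
  have h3 : (k : ℝ) * (1 / (2 * k)) = 1 / 2 := by field_simp
  linarith

/-- The strong law of large numbers for `log ‖Aₙ‖`. -/
theorem ae_tendsto_log_opNorm_div (h1 : HasMoment μ 1) :
    ∀ᵐ ω ∂P, Tendsto (fun n : ℕ => Real.log (opNorm (leftProd Y n ω)) / n) atTop
      (𝓝 (lyapunov μ)) := by
  have h2 : ∀ᵐ ω ∂P, ∀ (m : ℕ) (j : Fin d), ∀ᶠ k : ℕ in atTop,
      |cocycle (leftProd Y k ω) (vertex j) - k * lyapunov μ| < 2 * k * (1 / ((m : ℝ) + 1)) :=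
    ae_all_iff.2 fun m => ae_all_iff.2 fun j =>
      ae_eventually_abs_cocycle_sub_lt hY hind hlaw hμ h1 (vertex j) (by positivity)
  filter_upwards [h2] with ω hω
  rw [Metric.tendsto_atTop']
  intro ε hε
  obtain ⟨m, hm⟩ := exists_nat_one_div_lt (half_pos hε)
  have h3 := (eventually_all.2 (hω m)).and (eventually_gt_atTop 0)
  obtain ⟨N, hN⟩ := eventually_atTop.1 h3
  refine ⟨N, fun n hn => ?_⟩
  obtain ⟨h4, hn0⟩ := hN n hn.le
  have hn0' : (0 : ℝ) < n := by exact_mod_cast hn0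
  obtain ⟨j, hj⟩ := exists_log_opNorm_eq (leftProd Y n ω)
  have h5 := h4 j
  rw [← hj] at h5
  rw [Real.dist_eq, show Real.log (opNorm (leftProd Y n ω)) / n - lyapunov μ =
    (Real.log (opNorm (leftProd Y n ω)) - n * lyapunov μ) / n by field_simp, abs_div,
    abs_of_pos hn0', div_lt_iff₀ hn0']
  refine h5.trans ?_
  have := mul_lt_mul_of_pos_left hm (show (0 : ℝ) < 2 * n by positivity)
  linarith

omit [IsProbabilityMeasure P] [IsProbabilityMeasure μ] [MeasurableSpace Ω] hY hind hlaw hμ in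
lemma logN_leftProd_le (n : ℕ) (ω : Ω) :
    logN (leftProd Y n ω) ≤ ∑ i ∈ Finset.range n, logN (Y i ω) := by
  induction n with
  | zero => simp [leftProd, logN_one]
  | succ n ih =>
    rw [Finset.sum_range_succ, leftProd]
    linarith [logN_mul_le (Y n ω) (leftProd Y n ω)]

/-- Here `|W|` is at most a constant `c` plus `|Z|`, with `Z` the centred average of the `log
N(Y_i)`, which tends to zero in `L¹`. So `|W| ≤ min |W| c + |Z|`, and the bounded part is handled by
dominated convergence and the almost sure limit. -/
theorem tendsto_lintegral_log_opNorm_div (h1 : HasMoment μ 1) :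
    Tendsto (fun n : ℕ => ∫⁻ ω, ‖Real.log (opNorm (leftProd Y n ω)) / n - lyapunov μ‖ₑ ∂P) atTop
      (𝓝 0) := by
  have hint := h1.integrable_logN le_rfl
  have hcomp : ∀ i, Integrable (fun ω => logN (Y i ω)) P := fun i => by
    have := hint
    rw [← hlaw i] at this
    exact this.comp_measurable (hY i)
  have hslln := strong_law_Lp (μ := P) (p := 1) le_rfl ENNReal.one_ne_top
    (fun i ω => logN (Y i ω)) (memLp_one_iff_integrable.2 (hcomp 0))
    (fun i j hij => (hind.indepFun hij).comp measurable_logN measurable_logN)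
    (fun i => (IdentDistrib.mk (hY i).aemeasurable (hY 0).aemeasurable
      (by rw [hlaw, hlaw])).comp measurable_logN)
  simp only [eLpNorm_one_eq_lintegral_enorm] at hslln
  set m : ℝ := ∫ ω, logN (Y 0 ω) ∂P
  have hm0 : 0 ≤ m := integral_nonneg fun _ => logN_nonneg _
  set c : ℝ := m + |lyapunov μ|
  set W : ℕ → Ω → ℝ := fun n ω => Real.log (opNorm (leftProd Y n ω)) / n - lyapunov μ
  set Z : ℕ → Ω → ℝ := fun n ω => (n : ℝ)⁻¹ • ∑ i ∈ Finset.range n, logN (Y i ω) - m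
  have hW : ∀ n, Measurable (W n) := fun n =>
    (((measurable_opNorm.comp (measurable_leftProd hY n)).log).div_const _).sub_const _
  have hZ : ∀ n, Measurable (Z n) := fun n => by
    have h2 : Measurable fun ω => ∑ i ∈ Finset.range n, logN (Y i ω) :=
      Finset.measurable_sum _ fun i _ => measurable_logN.comp (hY i)
    exact (h2.const_smul (n : ℝ)⁻¹).sub_const m
  have hWZ : ∀ n ω, |W n ω| ≤ c + |Z n ω| := by
    intro n ω
    have h2 : |Real.log (opNorm (leftProd Y n ω)) / n| ≤ Z n ω + m := by
      simp only [Z, sub_add_cancel, smul_eq_mul]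
      rw [abs_div, Nat.abs_cast, div_eq_inv_mul]
      gcongr
      exact (abs_log_opNorm_le _).trans (logN_leftProd_le n ω)
    have h3 := abs_sub (Real.log (opNorm (leftProd Y n ω)) / n) (lyapunov μ)
    have h4 := le_abs_self (Z n ω)
    simp only [W, c]
    linarith
  have hbound : ∀ n, ∫⁻ ω, ‖W n ω‖ₑ ∂P ≤
      ∫⁻ ω, min ‖W n ω‖ₑ (ENNReal.ofReal c) ∂P + ∫⁻ ω, ‖Z n ω‖ₑ ∂P := by
    intro n
    rw [← lintegral_add_right _ (hZ n).enorm]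
    refine lintegral_mono fun ω => ?_
    rcases le_total ‖W n ω‖ₑ (ENNReal.ofReal c) with h | h
    · rw [min_eq_left h]; exact le_self_add
    · rw [min_eq_right h, Real.enorm_eq_ofReal_abs, Real.enorm_eq_ofReal_abs,
        ← ENNReal.ofReal_add (by positivity) (abs_nonneg _)]
      exact ENNReal.ofReal_le_ofReal (hWZ n ω)
  have hmin : Tendsto (fun n => ∫⁻ ω, min ‖W n ω‖ₑ (ENNReal.ofReal c) ∂P) atTop (𝓝 0) := by
    have := tendsto_lintegral_of_dominated_convergence (μ := P)
      (F := fun n ω => min ‖W n ω‖ₑ (ENNReal.ofReal c)) (f := fun _ => 0)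
      (fun _ => ENNReal.ofReal c) (fun n => (hW n).enorm.min measurable_const)
      (fun n => ae_of_all _ fun ω => min_le_right _ _) (by simp) (by
        filter_upwards [ae_tendsto_log_opNorm_div hY hind hlaw hμ h1] with ω hω
        have h5 : Tendsto (fun n => W n ω) atTop (𝓝 0) := by
          simpa using hω.sub_const (lyapunov μ)
        have h6 : Tendsto (fun n => ‖W n ω‖ₑ) atTop (𝓝 0) := by
          simpa using h5.enorm
        exact tendsto_of_tendsto_of_tendsto_of_le_of_le tendsto_const_nhds h6
          (fun _ => zero_le) fun _ => min_le_left _ _)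
    simpa using this
  have := hmin.add hslln
  rw [add_zero] at this
  exact tendsto_of_tendsto_of_tendsto_of_le_of_le tendsto_const_nhds this (fun _ => zero_le) hbound

end PosMat

/-! ### Column balance and the matrix coefficients -/

namespace PosMat

variable {d : ℕ} [NeZero d] {μ : Measure (G d)} [IsProbabilityMeasure μ]

lemma tsum_rpow_mul_pow_div_lt_top {q : ℝ} (hq0 : 0 ≤ q) (hq1 : q < 1) {r : ℕ} (hr : 1 ≤ r)
    (a : ℝ) : ∑' n : ℕ+, ENNReal.ofReal ((n : ℝ) ^ a) * ENNReal.ofReal (q ^ ((n : ℕ) / r)) < ∞ := by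
  -- Using `(1 + q) / 2` in place of `q` keeps the rate strictly positive even if `q = 0`, so that
  -- dividing by `s ^ r` is allowed.
  set s : ℝ := ((1 + q) / 2) ^ ((r : ℝ)⁻¹) with hs
  have hr0 : (r : ℝ) ≠ 0 := by positivity
  have hsr : s ^ r = (1 + q) / 2 := Real.rpow_inv_natCast_pow (by positivity) (by omega)
  have hs0 : 0 < s := by positivity
  have hs1 : s < 1 := Real.rpow_lt_one (by positivity) (by linarith) (by positivity)
  obtain ⟨k, hk⟩ := exists_nat_ge a
  have hsum : Summable fun n : ℕ => (n : ℝ) ^ k * s ^ n :=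
    summable_pow_mul_geometric_of_norm_lt_one k (by rwa [Real.norm_eq_abs, abs_of_pos hs0])
  have hfin : ∑' n : ℕ, ENNReal.ofReal ((s ^ r)⁻¹ * ((n : ℝ) ^ k * s ^ n)) < ∞ :=
    (hsum.mul_left _).tsum_ofReal_lt_top
  refine lt_of_le_of_lt (le_trans (ENNReal.tsum_le_tsum fun n => ?_)
    (ENNReal.tsum_comp_le_tsum_of_injective PNat.coe_injective
      fun n : ℕ => ENNReal.ofReal ((s ^ r)⁻¹ * ((n : ℝ) ^ k * s ^ n)))) hfin
  rw [← ENNReal.ofReal_mul (by positivity)]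
  refine ENNReal.ofReal_le_ofReal ?_
  have hn : (1 : ℝ) ≤ n := by exact_mod_cast n.pos
  have h1 : (n : ℝ) ^ a ≤ (n : ℝ) ^ k := by
    rw [← Real.rpow_natCast]; exact Real.rpow_le_rpow_of_exponent_le hn hk
  have h2 : q ^ ((n : ℕ) / r) ≤ (s ^ r)⁻¹ * s ^ (n : ℕ) := by
    rw [← div_eq_inv_mul, le_div_iff₀ (by positivity)]
    calc q ^ ((n : ℕ) / r) * s ^ r ≤ (s ^ r) ^ ((n : ℕ) / r) * s ^ r := by
          gcongr; rw [hsr]; linarith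
      _ = s ^ (r * ((n : ℕ) / r) + r) := by rw [pow_add, pow_mul]
      _ ≤ s ^ (n : ℕ) := by
          refine pow_le_pow_of_le_one hs0.le hs1.le ?_
          have := Nat.div_add_mod (n : ℕ) r
          have := Nat.mod_lt (n : ℕ) (show 0 < r by omega)
          omega
  calc (n : ℝ) ^ a * q ^ ((n : ℕ) / r) ≤ (n : ℝ) ^ k * ((s ^ r)⁻¹ * s ^ (n : ℕ)) := by gcongr
    _ = _ := by ring

lemma lintegral_logNN_add_rpow_lt_top {p : ℝ} (hp : 1 ≤ p) (h1 : HasMoment μ p)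
    (h2 : HasMoment (μ.map transpose) p) {L : ℝ} (hL : 0 ≤ L) (r : ℕ) :
    ∫⁻ g, ENNReal.ofReal ((logNN g + L) ^ p) ∂(convPow μ r) < ∞ := by
  have hp0 : 0 ≤ p := by linarith
  have key : ∀ {ν : Measure (G d)} [IsProbabilityMeasure ν] {a b : G d → ℝ}, (∀ g, 0 ≤ a g) →
      (∀ g, 0 ≤ b g) → Measurable a → ∫⁻ g, ENNReal.ofReal (a g ^ p) ∂ν < ∞ →
      ∫⁻ g, ENNReal.ofReal (b g ^ p) ∂ν < ∞ →
      ∫⁻ g, ENNReal.ofReal ((a g + b g) ^ p) ∂ν < ∞ := by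
    intro ν _ a b ha hb hm hfa hfb
    calc ∫⁻ g, ENNReal.ofReal ((a g + b g) ^ p) ∂ν
        ≤ ∫⁻ g, ENNReal.ofReal (2 ^ p) *
            (ENNReal.ofReal (a g ^ p) + ENNReal.ofReal (b g ^ p)) ∂ν := by
          refine lintegral_mono fun g => ?_
          rw [← ENNReal.ofReal_add (Real.rpow_nonneg (ha g) p) (Real.rpow_nonneg (hb g) p),
            ← ENNReal.ofReal_mul (by positivity)]
          exact ENNReal.ofReal_le_ofReal (add_rpow_le (ha g) (hb g) hp0)
      _ < ∞ := by
          rw [lintegral_const_mul' _ _ ENNReal.ofReal_ne_top,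
            lintegral_add_left (hm.pow_const p).ennreal_ofReal]
          exact ENNReal.mul_lt_top ENNReal.ofReal_lt_top (ENNReal.add_lt_top.2 ⟨hfa, hfb⟩)
  have h3 : ∫⁻ g, ENNReal.ofReal (logN (transpose g) ^ p) ∂μ < ∞ := by
    rw [HasMoment, lintegral_map _ measurable_transpose] at h2
    · exact h2
    · exact (measurable_logN.pow_const p).ennreal_ofReal
  have h4 : ∫⁻ g, ENNReal.ofReal (logNN g ^ p) ∂μ < ∞ :=
    key logN_nonneg (fun g => logN_nonneg (transpose g)) measurable_logN h1 h3
  exact key (b := fun _ => L) logNN_nonneg (fun _ => hL) measurable_logNN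
    (lintegral_rpow_convPow_lt_top μ measurable_logNN logNN_nonneg logNN_mul_le hp0 h4 r)
    (by simp)

/-- Peel off the leftmost block `Z` of length `r` and split the allowance as `x = (1 - ρ) x + ρ x`.
If `Z` does not exhaust the first share, imbalance of `Z * h` forces both that `Z` has an entry
outside `[1/M, M]` and that `h` is unbalanced at level `ρ x`; these events are independent. -/
lemma measure_not_colBalanced_add_le {M ρ x : ℝ} (hM : 1 ≤ M) (hρ0 : 0 ≤ ρ)
    (hx : 0 ≤ x) (r m : ℕ) :
    convPow μ (r + m) {g | ¬ ColBalanced g x} ≤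
      convPow μ r {g | (1 - ρ) * x ≤ logNN g + Real.log (d * M * M)} +
        convPow μ r (entriesBounded d M)ᶜ * convPow μ m {g | ¬ ColBalanced g (ρ * x)} := by
  set L := Real.log (d * M * M)
  have hd1 : (1 : ℝ) ≤ d := by exact_mod_cast Nat.one_le_iff_ne_zero.2 (NeZero.ne d)
  have hs : ∀ y : ℝ, MeasurableSet {g : G d | ¬ ColBalanced g y} := fun y =>
    (measurableSet_colBalanced y).compl
  have hsW : MeasurableSet {g : G d | (1 - ρ) * x ≤ logNN g + L} :=
    measurableSet_le measurable_const (measurable_logNN.add_const L)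
  have hsK := (measurableSet_entriesBounded (d := d) M).compl
  rw [← lintegral_indicator_one (hs x),
    lintegral_convPow_add μ r m (measurable_one.indicator (hs x))]
  calc _ ≤ ∫⁻ Z, ∫⁻ h, ({g : G d | (1 - ρ) * x ≤ logNN g + L}.indicator 1 Z +
        (entriesBounded d M)ᶜ.indicator 1 Z *
          {g : G d | ¬ ColBalanced g (ρ * x)}.indicator 1 h) ∂(convPow μ m) ∂(convPow μ r) := by
        refine lintegral_mono fun Z => lintegral_mono fun h => ?_
        by_cases hb : ColBalanced (Z * h) x
        · rw [Set.indicator_of_notMem (by simpa using hb)]; exact zero_le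
        by_cases hw : (1 - ρ) * x ≤ logNN Z + L
        · rw [Set.indicator_of_mem (s := {g : G d | (1 - ρ) * x ≤ logNN g + L}) hw]
          exact le_add_right (Set.indicator_le_self _ _ _)
        have hw' := not_le.1 hw
        have hZ : Z ∉ entriesBounded d M := fun hZ => hb <| by
          refine (colBalanced_mul_of_entriesBounded (by linarith) hZ h).mono ?_
          have := logNN_nonneg Z
          have : 0 ≤ ρ * x := by positivity
          change L ≤ x
          linarith
        have hh : ¬ ColBalanced h (ρ * x) := fun hh => hb <| (hh.mul Z).mono (by
          have : 0 ≤ L := Real.log_nonneg (by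
            have : 1 ≤ d * M := one_le_mul_of_one_le_of_one_le hd1 hM
            exact one_le_mul_of_one_le_of_one_le this hM)
          linarith)
        rw [Set.indicator_of_mem (s := (entriesBounded d M)ᶜ) hZ,
          Set.indicator_of_mem (s := {g : G d | ¬ ColBalanced g (ρ * x)}) hh]
        refine (Set.indicator_le_self _ _ _).trans ?_
        simp
    _ = _ := by
        have h1 : ∀ Z : G d, ∫⁻ h, ({g : G d | (1 - ρ) * x ≤ logNN g + L}.indicator 1 Z +
            (entriesBounded d M)ᶜ.indicator 1 Z *
              {g : G d | ¬ ColBalanced g (ρ * x)}.indicator 1 h) ∂(convPow μ m) =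
            {g : G d | (1 - ρ) * x ≤ logNN g + L}.indicator 1 Z +
            (entriesBounded d M)ᶜ.indicator 1 Z *
              convPow μ m {g | ¬ ColBalanced g (ρ * x)} := fun Z => by
          rw [lintegral_add_left measurable_const,
            lintegral_const_mul _ (measurable_one.indicator (hs _)),
            lintegral_indicator_one (hs _)]
          simp
        simp only [h1]
        rw [lintegral_add_left (measurable_one.indicator hsW),
          lintegral_mul_const _ (measurable_one.indicator hsK), lintegral_indicator_one hsW,
          lintegral_indicator_one hsK]

lemma measure_not_colBalanced_le {M ρ : ℝ} (hM : 1 ≤ M) (hρ0 : 0 ≤ ρ) (r s J : ℕ) {x : ℝ}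
    (hx : 0 ≤ x) :
    convPow μ (J * r + s) {g | ¬ ColBalanced g x} ≤
      ∑ j ∈ Finset.range J, convPow μ r (entriesBounded d M)ᶜ ^ j *
        convPow μ r {g | (1 - ρ) * ρ ^ j * x ≤ logNN g + Real.log (d * M * M)} +
      convPow μ r (entriesBounded d M)ᶜ ^ J := by
  induction J generalizing x with
  | zero => simpa using prob_le_one
  | succ J ih =>
    rw [show (J + 1) * r + s = r + (J * r + s) by ring]
    refine (measure_not_colBalanced_add_le hM hρ0 hx r _).trans ?_
    refine (add_le_add_right (mul_le_mul_right (ih (mul_nonneg hρ0 hx)) _) _).trans (le_of_eq ?_)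
    rw [Finset.sum_range_succ', mul_add, Finset.mul_sum]
    have h1 : ∀ j, (1 - ρ) * ρ ^ j * (ρ * x) = (1 - ρ) * ρ ^ (j + 1) * x := fun j => by ring
    simp only [h1, ← mul_assoc, ← pow_succ', pow_zero, one_mul, mul_one]
    ring

/-- The `j`-th peeled block contributes `q ^ j` times a tail at level proportional to `ρ ^ j * n ^
α`, whose weighted sum over `n` is of order `ρ ^ (-p * j)` by the moment of `logNN`. It remains to
have `q < ρ ^ p`; the case where no block is good is exponentially small in `n`. -/
lemma tsum_measure_not_colBalanced_lt_top (hμ : StrictlyContracting μ) {p α : ℝ} (hp : 1 ≤ p)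
    (h1 : HasMoment μ p) (h2 : HasMoment (μ.map transpose) p) (hα : 0 < α) (hαp : 1 ≤ α * p)
    {ε : ℝ} (hε : 0 < ε) :
    ∑' n : ℕ+, ENNReal.ofReal ((n : ℝ) ^ (α * p - 2)) *
      convPow μ n {g | ¬ ColBalanced g ((n : ℝ) ^ α * ε)} < ∞ := by
  obtain ⟨r, hr, M, hM, hpos⟩ := hμ.exists_entriesBounded
  set K := entriesBounded d M
  set ν := convPow μ r
  set L := Real.log (d * M * M)
  have hd1 : (1 : ℝ) ≤ d := by exact_mod_cast Nat.one_le_iff_ne_zero.2 (NeZero.ne d)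
  have hL : 0 ≤ L := Real.log_nonneg (by
    have : 1 ≤ d * M := one_le_mul_of_one_le_of_one_le hd1 hM
    exact one_le_mul_of_one_le_of_one_le this hM)
  have hq : ν Kᶜ < 1 := by
    rw [prob_compl_eq_one_sub (measurableSet_entriesBounded M)]
    exact ENNReal.sub_lt_self ENNReal.one_ne_top one_ne_zero hpos.ne'
  set q : ℝ := (ν Kᶜ).toReal
  have hqν : ν Kᶜ = ENNReal.ofReal q := (ENNReal.ofReal_toReal hq.ne_top).symm
  have hq0 : 0 ≤ q := ENNReal.toReal_nonneg
  have hq1 : q < 1 := by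
    have := (ENNReal.toReal_lt_toReal hq.ne_top ENNReal.one_ne_top).2 hq
    rwa [ENNReal.toReal_one] at this
  -- Chosen so that `ρ ^ p = (1 + q) / 2` lies strictly between `q` and `1`.
  set ρ : ℝ := ((1 + q) / 2) ^ p⁻¹
  have hp0 : 0 < p := by linarith
  have hρ0 : 0 < ρ := by positivity
  have hρ1 : ρ < 1 := Real.rpow_lt_one (by positivity) (by linarith) (by positivity)
  have hρp : ρ ^ p = (1 + q) / 2 := Real.rpow_inv_rpow (by positivity) hp0.ne'
  have hρ1' : 0 < 1 - ρ := by linarith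
  set W := ∫⁻ g, ENNReal.ofReal ((logNN g + L) ^ p) ∂ν
  have hW : W < ∞ := lintegral_logNN_add_rpow_lt_top hp h1 h2 hL r
  have hterm : ∀ n : ℕ+, ENNReal.ofReal ((n : ℝ) ^ (α * p - 2)) *
      convPow μ n {g | ¬ ColBalanced g ((n : ℝ) ^ α * ε)} ≤
      ∑' j : ℕ, ENNReal.ofReal q ^ j * (ENNReal.ofReal ((n : ℝ) ^ (α * p - 2)) * ((n : ℝ≥0∞) *
        ν {g | ((1 - ρ) * ρ ^ j * ε) * (n : ℝ) ^ α ≤ logNN g + L})) +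
      ENNReal.ofReal ((n : ℝ) ^ (α * p - 2)) * ENNReal.ofReal (q ^ ((n : ℕ) / r)) := by
    intro n
    have h3 := measure_not_colBalanced_le (μ := μ) hM hρ0.le r ((n : ℕ) % r) ((n : ℕ) / r)
      (x := (n : ℝ) ^ α * ε) (by positivity)
    rw [Nat.div_add_mod'] at h3
    change _ ≤ ∑ j ∈ Finset.range ((n : ℕ) / r), ν Kᶜ ^ j * _ + ν Kᶜ ^ ((n : ℕ) / r) at h3
    rw [hqν] at h3
    refine (mul_le_mul_right h3 _).trans ?_
    rw [mul_add, ENNReal.ofReal_pow hq0]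
    gcongr
    rw [Finset.mul_sum]
    refine le_trans (Finset.sum_le_sum fun j _ => ?_) (ENNReal.sum_le_tsum _)
    rw [mul_left_comm]
    gcongr
    -- The tail probability is enlarged by a factor `n` only to fit the form of
    -- `tsum_mul_measure_le`.
    have hn : (1 : ℝ≥0∞) ≤ ((n : ℕ) : ℝ≥0∞) := by exact_mod_cast n.pos
    refine le_trans (measure_mono fun g hg => ?_) (le_mul_of_one_le_left' hn)
    simp only [Set.mem_ofPred_eq] at hg ⊢
    linarith
  refine lt_of_le_of_lt (ENNReal.tsum_le_tsum hterm) ?_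
  rw [ENNReal.tsum_add]
  refine ENNReal.add_lt_top.2 ⟨?_, tsum_rpow_mul_pow_div_lt_top hq0 hq1 hr _⟩
  rw [ENNReal.tsum_comm]
  simp only [ENNReal.tsum_mul_left]
  have hj : ∀ j : ℕ, ENNReal.ofReal q ^ j * ∑' n : ℕ+, (ENNReal.ofReal ((n : ℝ) ^ (α * p - 2)) *
      ((n : ℝ≥0∞) * ν {g | ((1 - ρ) * ρ ^ j * ε) * (n : ℝ) ^ α ≤ logNN g + L})) ≤
      ENNReal.ofReal (((1 - ρ) * ε) ^ (-p) * (q * ((1 + q) / 2)⁻¹) ^ j) * W := by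
    intro j
    have h4 := RandomChain.tsum_mul_measure_le (μ := ν) (ξ := fun g => logNN g + L)
      (measurable_logNN.add_const L) (fun g => add_nonneg (logNN_nonneg g) hL) hα hαp
      (δ := (1 - ρ) * ρ ^ j * ε) (by positivity)
    refine (mul_le_mul_right h4 _).trans (le_of_eq ?_)
    rw [← mul_assoc, ← ENNReal.ofReal_pow hq0, ← ENNReal.ofReal_mul (by positivity)]
    congr 2
    rw [show (1 - ρ) * ρ ^ j * ε = ((1 - ρ) * ε) * ρ ^ j by ring,
      Real.mul_rpow (by positivity) (by positivity), ← Real.rpow_natCast_mul hρ0.le,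
      mul_comm (j : ℝ), Real.rpow_mul_natCast hρ0.le, Real.rpow_neg hρ0.le, hρp, mul_pow]
    ring
  refine lt_of_le_of_lt (ENNReal.tsum_le_tsum hj) ?_
  rw [ENNReal.tsum_mul_right]
  refine ENNReal.mul_lt_top (Summable.tsum_ofReal_lt_top (Summable.mul_left _
    (summable_geometric_of_lt_one (by positivity) ?_))) hW
  rw [← div_eq_mul_inv, div_lt_one (by positivity)]
  linarith

lemma logCoeff_bounds {g : G d} {z : ℝ} (hg : ColBalanced g z) (x y : simplex d) :
    ∃ l : ℝ, logCoeff g x y = l ∧ Real.log (lowNorm g) - z ≤ l ∧ l ≤ Real.log (opNorm g) := by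
  set c := dotProduct y.1 (g.1.mulVec x.1)
  have hlow : Real.exp (-z) * lowNorm g ≤ c := by
    have h1 : ∀ i, Real.exp (-z) * lowNorm g ≤ g.1.mulVec x.1 i := fun i => by
      have h2 : ∀ j, Real.exp (-z) * lowNorm g ≤ g.1 i j := fun j => by
        have h3 := (lowNorm_le_colSum g j).trans (hg i j)
        rw [Real.exp_neg]
        rwa [inv_mul_le_iff₀ (Real.exp_pos z)]
      calc Real.exp (-z) * lowNorm g = ∑ j, Real.exp (-z) * lowNorm g * x.1 j := by
            rw [← Finset.mul_sum, sum_simplex, mul_one]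
        _ ≤ _ := Finset.sum_le_sum fun j _ => mul_le_mul_of_nonneg_right (h2 j) (x.2.2 j)
    calc Real.exp (-z) * lowNorm g = ∑ i, y.1 i * (Real.exp (-z) * lowNorm g) := by
          rw [← Finset.sum_mul, sum_simplex, one_mul]
      _ ≤ _ := Finset.sum_le_sum fun i _ => mul_le_mul_of_nonneg_left (h1 i) (y.2.2 i)
  have hup : c ≤ opNorm g := by
    have h1 := mulVec_le_opNorm g x.2.2
    rw [sum_simplex, mul_one, l1Norm_of_nonneg (mulVec_nonneg g x.2.2)] at h1
    refine le_trans (Finset.sum_le_sum fun i _ => ?_) h1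
    refine mul_le_of_le_one_left (mulVec_nonneg g x.2.2 i) ?_
    rw [← sum_simplex y]
    exact Finset.single_le_sum (f := y.1) (fun i _ => y.2.2 i) (Finset.mem_univ i)
  have hpos : 0 < Real.exp (-z) * lowNorm g := mul_pos (Real.exp_pos _) (lowNorm_pos g)
  have hc : 0 < c := hpos.trans_le hlow
  refine ⟨Real.log c, ENNReal.log_ofReal_of_pos hc, ?_, Real.log_le_log hc hup⟩
  have := Real.log_le_log hpos hlow
  rw [Real.log_mul (Real.exp_pos _).ne' (lowNorm_pos g).ne', Real.log_exp] at this
  linarith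

/-- Both `log ‖g‖` and `log v(g)` are values of the cocycle at vertices, so finitely many deviations
control the supremum over all `x` and `y`. -/
lemma iSup_abs_logCoeff_sub_lt {g : G d} {z s l : ℝ} (hz : 0 ≤ z) (hg : ColBalanced g z)
    (hs : ∀ j, |cocycle g (vertex j) - l| < s) :
    ⨆ x : simplex d, ⨆ y : simplex d, (logCoeff g x y - (l : EReal)).abs <
      ENNReal.ofReal (s + z) := by
  have hop : |Real.log (opNorm g) - l| < s := by
    obtain ⟨j, hj⟩ := exists_log_opNorm_eq g
    rw [hj]; exact hs j
  have hlow : |Real.log (lowNorm g) - l| < s := by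
    obtain ⟨j, hj⟩ := exists_lowNorm_eq g
    rw [hj, ← cocycle_vertex]; exact hs j
  -- A strict inequality may be lost in a supremum; the attained maximum `t < s` gives a uniform
  -- bound strictly below `s + z`.
  set t := max |Real.log (opNorm g) - l| |Real.log (lowNorm g) - l|
  have ht : t < s := max_lt hop hlow
  have ht0 : 0 ≤ t := (abs_nonneg _).trans (le_max_left _ _)
  refine lt_of_le_of_lt (iSup₂_le fun x y => ?_)
    ((ENNReal.ofReal_lt_ofReal_iff (by linarith)).2 (add_lt_add_left ht z))
  obtain ⟨a, ha, ha1, ha2⟩ := logCoeff_bounds hg x y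
  rw [ha, ← EReal.coe_sub, EReal.abs_def]
  refine ENNReal.ofReal_le_ofReal (abs_le.2 ⟨?_, ?_⟩)
  · have h1 := (abs_le.1 (le_max_right |Real.log (opNorm g) - l| |Real.log (lowNorm g) - l|)).1
    change -t ≤ _ at h1
    linarith
  · have h1 := (abs_le.1 (le_max_left |Real.log (opNorm g) - l| |Real.log (lowNorm g) - l|)).2
    change _ ≤ t at h1
    linarith

end PosMat

end

theorem mainTheorem12 {d : ℕ} (hd : 2 ≤ d)
    (μ : Measure (PosMat.G d)) [IsProbabilityMeasure μ]
    {Ω : Type*} [MeasurableSpace Ω] (P : Measure Ω) [IsProbabilityMeasure P]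
    (Y : ℕ → Ω → PosMat.G d)
    (hYmeas : ∀ n, Measurable (Y n))
    (hYindep : iIndepFun Y P)
    (hYlaw : ∀ n, P.map (Y n) = μ)
    (hμ : PosMat.StrictlyContracting μ)
    (p : ℝ) (hp : 1 ≤ p) (hmom : PosMat.HasMoment μ p)
    (α : ℝ) (hα : α ∈ Set.Ioc (1 / 2 : ℝ) 1) (hαp : 1 / p ≤ α) :
    -- `λ_μ` is the almost sure and `L¹` limit of `(1/n) log ‖A_n‖`
    ((∀ᵐ ω ∂P, Tendsto
        (fun n : ℕ => Real.log (PosMat.opNorm (PosMat.leftProd Y n ω)) / (n : ℝ))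
        atTop (𝓝 (PosMat.lyapunov μ))) ∧
      Tendsto (fun n : ℕ => ∫⁻ ω,
          ‖Real.log (PosMat.opNorm (PosMat.leftProd Y n ω)) / (n : ℝ) - PosMat.lyapunov μ‖ₑ ∂P)
        atTop (𝓝 0)) ∧
    -- deviations of the norm cocycle
    (∀ ε : ℝ, 0 < ε →
      ∑' n : ℕ+, ENNReal.ofReal ((n : ℝ) ^ (α * p - 2)) *
        ⨆ x : PosMat.simplex d,
          P {ω | ENNReal.ofReal ((n : ℝ) ^ α * ε) ≤
            ⨆ k ∈ Finset.Icc 1 (n : ℕ),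
              ‖PosMat.cocycle (PosMat.leftProd Y k ω) x - (k : ℝ) * PosMat.lyapunov μ‖ₑ} < ∞) ∧
    -- deviations of the matrix coefficients
    (PosMat.HasMoment (μ.map PosMat.transpose) p →
      ∀ ε : ℝ, 0 < ε →
        ∑' n : ℕ+, ENNReal.ofReal ((n : ℝ) ^ (α * p - 2)) *
          P {ω | ENNReal.ofReal ((n : ℝ) ^ α * ε) ≤
            ⨆ x : PosMat.simplex d, ⨆ y : PosMat.simplex d,
              (PosMat.logCoeff (PosMat.leftProd Y n ω) x y
                - (((n : ℝ) * PosMat.lyapunov μ : ℝ) : EReal)).abs} < ∞) := by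
  have : NeZero d := ⟨by omega⟩
  have hα0 : 0 < α := by linarith [hα.1]
  have hαp1 : 1 ≤ α * p := by rwa [div_le_iff₀ (by linarith)] at hαp
  have h1 : PosMat.HasMoment μ 1 := by
    have := (PosMat.HasMoment.integrable_logN hp hmom).2
    rw [hasFiniteIntegral_iff_ofReal (ae_of_all _ PosMat.logN_nonneg)] at this
    simpa [PosMat.HasMoment, PosMat.logN] using this
  refine ⟨⟨PosMat.ae_tendsto_log_opNorm_div hYmeas hYindep hYlaw hμ h1,
    PosMat.tendsto_lintegral_log_opNorm_div hYmeas hYindep hYlaw hμ h1⟩, fun ε hε => ?_,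
    fun h2 ε hε => ?_⟩
  · obtain ⟨b, hb, hbd⟩ := PosMat.exists_cocycle_maximal_bound hYmeas hYindep hYlaw hμ hp hmom
      hα.1 hαp1 hε
    refine lt_of_le_of_lt (ENNReal.tsum_le_tsum fun n => ?_) hb
    gcongr
    refine iSup_le fun x => le_trans (measure_mono fun ω hω => ?_) (hbd x n n.pos)
    have hn : (0 : ℝ) < n := by exact_mod_cast n.pos
    by_contra hcon
    simp only [Set.mem_ofPred_eq, not_exists, not_and, not_le] at hcon hω
    -- A finite supremum stays strictly below a bound that all terms stay below, provided the bound
    -- is positive; this turns the supremum into the existence of `k`.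
    rw [← Finset.sup_eq_iSup] at hω
    refine absurd hω (not_le.2 ((Finset.sup_lt_iff ?_).2 fun k hk => ?_))
    · exact ENNReal.ofReal_pos.2 (by positivity)
    · rw [Real.enorm_eq_ofReal_abs]
      exact (ENNReal.ofReal_lt_ofReal_iff (by positivity)).2 (hcon k (Finset.mem_Icc.1 hk).2)
  · obtain ⟨b, hb, hbd⟩ := PosMat.exists_cocycle_maximal_bound hYmeas hYindep hYlaw hμ hp hmom
      hα.1 hαp1 (half_pos hε)
    have h3 := PosMat.tsum_measure_not_colBalanced_lt_top hμ hp hmom h2 hα0 hαp1 (half_pos hε)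
    have h4 := ENNReal.add_lt_top.2 ⟨ENNReal.mul_lt_top (ENNReal.natCast_lt_top d) hb, h3⟩
    rw [← ENNReal.tsum_mul_left, ← ENNReal.tsum_add] at h4
    refine lt_of_le_of_lt (ENNReal.tsum_le_tsum fun n => ?_) h4
    have hn : (0 : ℝ) < n := by exact_mod_cast n.pos
    rw [mul_left_comm, ← mul_add]
    gcongr
    have hsm : MeasurableSet
        {g : PosMat.G d | ¬ PosMat.ColBalanced g ((n : ℝ) ^ α * (ε / 2))} :=
      (PosMat.measurableSet_colBalanced _).compl
    rw [← PosMat.map_leftProd hYmeas hYindep hYlaw, Measure.map_apply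
      (PosMat.measurable_leftProd hYmeas n) hsm]
    -- The supremum over `x` now sits inside the probability; a union bound over the `d` vertices
    -- replaces it, with half of `ε` for the cocycle and half for the column balance.
    have h5 : P (⋃ j : Fin d, {ω | ∃ k ≤ (n : ℕ), (n : ℝ) ^ α * (ε / 2) ≤
        |PosMat.cocycle (PosMat.leftProd Y k ω) (PosMat.vertex j) - k * PosMat.lyapunov μ|}) ≤
        d * b n := by
      refine (measure_iUnion_fintype_le _ _).trans ((Finset.sum_le_sum fun j _ =>
        hbd (PosMat.vertex j) n n.pos).trans (by simp))
    refine le_trans (measure_mono fun ω hω => ?_)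
      ((measure_union_le _ _).trans (add_le_add_left h5 _))
    by_contra hcon
    simp only [Set.mem_union, Set.mem_iUnion, Set.mem_ofPred_eq, Set.mem_preimage, not_or,
      not_exists, not_and, not_le, not_not] at hcon hω
    have h6 := PosMat.iSup_abs_logCoeff_sub_lt (by positivity) hcon.2
      (fun j => hcon.1 j n le_rfl)
    rw [← mul_add, add_halves] at h6
    exact absurd hω (not_le.2 h6)
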